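/- Let $H$ be a complex Hilbert space and let $B(H)$ be the algebra of bounded operators on $H$. A spectral measure $E$ is a map from the Borel subsets of $\mathbb{C}$ to $B(H)$, countably additive in the strong sense, with $E(\mathbb{C})=I$ and $E(A\cap B)=E(A)E(B)$ (the projections $E(A)$ need not be self-adjoint). Integrals $\int_S G(\lambda)\,dE(\lambda)$ of operator-valued functions, and double integrals against two spectral measures, are norm limits of Riemann sums over finite tagged Borel partitions, directed by refinement. We say that $X\in B(H)$ has the spectral decomposition $$X=\int_{\sigma(X)}\lambda\,dE(\lambda)+\int_{\sigma(X)}(X-\lambda I)\,dE(\lambda)$$ with nilpotent orders $m_\lambda$ if $E$ is a spectral measure with $E(\sigma(X))=I$ that commutes with $X$, both integrals exist and sum to $X$, and $\lambda\mapsto m_\lambda\in\mathbb{N}$ is a Borel function, bounded on $\sigma(X)$, such that $[(X-\lambda I)\,dE(\lambda)]^{\ell}=0$ whenever $\ell\ge m_\lambda$, i.e. $\int_{\{\lambda\in\sigma(X)\,:\,m_\lambda\le\ell\}}(X-\lambda I)^{\ell}\,dE(\lambda)=0$ for every integer $\ell\ge 0$. For $X_1,X_2$ with such decompositions $(E_1,m_{\lambda_1})$,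 $(E_2,m_{\lambda_2})$, for a function $\beta(\lambda_1,\lambda_2)$ and for $Z\in B(H)$, the generalized double operator integral $T_\beta^{X_1,X_2}(Z)$ is the sum of the following four double integrals over $\lambda_1\in\sigma(X_1)$, $\lambda_2\in\sigma(X_2)$, provided that all of them exist: $$\begin{aligned} T_\beta^{X_1,X_2}(Z)={}&\iint \beta(\lambda_1,\lambda_2)\,dE_1(\lambda_1)\,Z\,dE_2(\lambda_2)\\ &+\iint\sum_{q_2=1}^{m_{\lambda_2}-1}\frac{\partial_2^{q_2}\beta(\lambda_1,\lambda_2)}{q_2!}\,dE_1(\lambda_1)\,Z\,(X_2-\lambda_2I)^{q_2}dE_2(\lambda_2)\\ &+\iint\sum_{q_1=1}^{m_{\lambda_1}-1}\frac{\partial_1^{q_1}\beta(\lambda_1,\lambda_2)}{q_1!}\,(X_1-\lambda_1I)^{q_1}dE_1(\lambda_1)\,Z\,dE_2(\lambda_2)\\ &+\iint\sum_{q_1=1}^{m_{\lambda_1}-1}\sum_{q_2=1}^{m_{\lambda_2}-1}\frac{\partial_1^{q_1}\partial_2^{q_2}\beta(\lambda_1,\lambda_2)}{q_1!\,q_2!}\,(X_1-\lambda_1I)^{q_1}dE_1(\lambda_1)\,Z\,(X_2-\lambda_2I)^{q_2}dE_2(\lambda_2).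 \end{aligned}$$ **Theorem.** Let $f$ be analytic on $\{|z|<R\}$. Let $X_1,X_2\in B(H)$ have spectral decompositions as above, with $|\lambda_1|<R$ for all $\lambda_1\in\sigma(X_1)$, $|\lambda_2|<R$ for all $\lambda_2\in\sigma(X_2)$, and $\lambda_1\neq\lambda_2$ for all $\lambda_1\in\sigma(X_1)$, $\lambda_2\in\sigma(X_2)$. Put $f^{[1]}(x_1,x_2)=\dfrac{f(x_1)-f(x_2)}{x_1-x_2}$ for $x_1\ne x_2$. Then the series $f(X_j)=\sum_{n\ge 0}\frac{f^{(n)}(0)}{n!}X_j^n$ converge in operator norm for $j=1,2$; for every $Y\in B(H)$ the operator $T^{X_1,X_2}_{f^{[1]}}(X_1Y-YX_2)$ exists, and $$f(X_1)Y-Yf(X_2)=T^{X_1,X_2}_{f^{[1]}}(X_1Y-YX_2).$$ In particular, taking $Y=I$, $$f(X_1)-f(X_2)=T^{X_1,X_2}_{f^{[1]}}(X_1-X_2).$$ -/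

import Mathlib

open Filter Topology

/-- A countably additive spectral measure on the Borel sets of `ℂ` with values in the bounded
(not necessarily self-adjoint) projections of a complex Hilbert space `H`. The values on sets that
are not Borel are irrelevant. -/
structure SpectralMeasure (H : Type*) [NormedAddCommGroup H] [InnerProductSpace ℂ H] where
  toFun : Set ℂ → (H →L[ℂ] H)
  map_univ : toFun Set.univ = 1
  map_inter : ∀ A B : Set ℂ, MeasurableSet A → MeasurableSet B →
    toFun (A ∩ B) = toFun A * toFun B
  hasSum_iUnion : ∀ A : ℕ → Set ℂ, (∀ n, MeasurableSet (A n)) →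
    Pairwise (fun i j => Disjoint (A i) (A j)) →
    ∀ x : H, HasSum (fun n => toFun (A n) x) (toFun (⋃ n, A n) x)

instance {H : Type*} [NormedAddCommGroup H] [InnerProductSpace ℂ H] :
    CoeFun (SpectralMeasure H) (fun _ => Set ℂ → (H →L[ℂ] H)) := ⟨SpectralMeasure.toFun⟩

/-- A partition of `S ⊆ ℂ` into finitely many nonempty Borel pieces, with a chosen point (tag) in
each piece. -/
structure TaggedPartition (S : Set ℂ) where
  parts : Finset (Set ℂ)
  measurableSet : ∀ A ∈ parts, MeasurableSet A
  disjoint : ∀ A ∈ parts, ∀ B ∈ parts, A ≠ B → Disjoint A B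
  union_eq : ⋃ A ∈ parts, A = S
  tag : Set ℂ → ℂ
  tag_mem : ∀ A ∈ parts, tag A ∈ A

namespace TaggedPartition

/-- `P ≤ Q` means that `Q` refines `P`; the tags play no role. -/
instance (S : Set ℂ) : Preorder (TaggedPartition S) where
  le P Q := ∀ B ∈ Q.parts, ∃ A ∈ P.parts, B ⊆ A
  le_refl _ B hB := ⟨B, hB, subset_rfl⟩
  le_trans P Q R h₁ h₂ C hC := by
    obtain ⟨B, hB, hCB⟩ := h₂ C hC
    obtain ⟨A, hA, hBA⟩ := h₁ B hB
    exact ⟨A, hA, hCB.trans hBA⟩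

open Classical in
/-- Any two tagged partitions have a common refinement. -/
instance (S : Set ℂ) : IsDirectedOrder (TaggedPartition S) where
  directed P Q := by
    refine ⟨⟨((P.parts ×ˢ Q.parts).image (fun p => p.1 ∩ p.2)).filter Set.Nonempty, ?_, ?_, ?_,
      fun A => if h : A.Nonempty then h.some else 0, ?_⟩, ?_, ?_⟩
    · intro A hA
      simp only [Finset.mem_filter, Finset.mem_image, Finset.mem_product, Prod.exists] at hA
      obtain ⟨⟨a, b, ⟨ha, hb⟩, rfl⟩, _⟩ := hA
      exact (P.measurableSet a ha).inter (Q.measurableSet b hb)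
    · intro A hA B hB hne
      simp only [Finset.mem_filter, Finset.mem_image, Finset.mem_product, Prod.exists] at hA hB
      obtain ⟨⟨a, b, ⟨ha, hb⟩, rfl⟩, _⟩ := hA
      obtain ⟨⟨c, d, ⟨hc, hd⟩, rfl⟩, _⟩ := hB
      by_cases hac : a = c
      · have hbd : b ≠ d := by
          rintro rfl
          exact hne (by rw [hac])
        exact (Q.disjoint b hb d hd hbd).mono Set.inter_subset_right Set.inter_subset_right
      · exact (P.disjoint a ha c hc hac).mono Set.inter_subset_left Set.inter_subset_left
    · ext z
      simp only [Set.mem_iUnion, Finset.mem_filter, Finset.mem_image, Finset.mem_product,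
        Prod.exists, exists_prop]
      constructor
      · rintro ⟨A, ⟨⟨a, b, ⟨ha, _⟩, rfl⟩, _⟩, hz⟩
        rw [← P.union_eq]
        exact Set.mem_biUnion ha hz.1
      · intro hz
        have h₁ := hz
        have h₂ := hz
        rw [← P.union_eq] at h₁
        rw [← Q.union_eq] at h₂
        simp only [Set.mem_iUnion, exists_prop] at h₁ h₂
        obtain ⟨a, ha, hza⟩ := h₁
        obtain ⟨b, hb, hzb⟩ := h₂
        exact ⟨a ∩ b, ⟨⟨a, b, ⟨ha, hb⟩, rfl⟩, ⟨z, hza, hzb⟩⟩, hza, hzb⟩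
    · intro A hA
      have h : A.Nonempty := (Finset.mem_filter.1 hA).2
      simp only [h, dif_pos]
      exact h.some_mem
    · intro A hA
      simp only [Finset.mem_filter, Finset.mem_image, Finset.mem_product, Prod.exists] at hA
      obtain ⟨⟨a, b, ⟨ha, _⟩, rfl⟩, _⟩ := hA
      exact ⟨a, ha, Set.inter_subset_left⟩
    · intro A hA
      simp only [Finset.mem_filter, Finset.mem_image, Finset.mem_product, Prod.exists] at hA
      obtain ⟨⟨a, b, ⟨_, hb⟩, rfl⟩, _⟩ := hA
      exact ⟨b, hb, Set.inter_subset_right⟩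

/-- Every Borel set has a tagged partition. -/
theorem nonempty_of_measurableSet {S : Set ℂ} (hS : MeasurableSet S) :
    Nonempty (TaggedPartition S) := by
  rcases S.eq_empty_or_nonempty with rfl | ⟨z, hz⟩
  · exact ⟨⟨∅, by simp, by simp, by simp, fun _ => 0, by simp⟩⟩
  · exact ⟨⟨{S}, by simpa using hS, by simp, by simp, fun _ => z, by simpa using hz⟩⟩

end TaggedPartition

section Integrals

variable {H : Type*} [NormedAddCommGroup H] [InnerProductSpace ℂ H]

/-- `T = ∫_{λ ∈ S} G(λ) dE(λ)`: the Riemann sums `∑ G(tag A) E(A)` over tagged Borel partitions of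
`S` converge to `T` in operator norm as the partitions are refined. -/
def HasSpectralIntegral (E : SpectralMeasure H) (S : Set ℂ) (G : ℂ → (H →L[ℂ] H))
    (T : H →L[ℂ] H) : Prop :=
  Tendsto (fun P : TaggedPartition S => ∑ A ∈ P.parts, G (P.tag A) * E A) atTop (𝓝 T)

/-- `X` has the "projection + nilpotent" spectral decomposition
`X = ∫ λ dE(λ) + ∫ (X - λ I) dE(λ)` over `σ(X)`, where `(X - λ I) dE(λ)` is nilpotent of
order (at most) `m λ`. -/
structure IsSpectralDecomposition (X : H →L[ℂ] H) (E : SpectralMeasure H) (m : ℂ → ℕ) :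
    Prop where
  measure_spectrum : E (spectrum ℂ X) = 1
  commute : ∀ A : Set ℂ, MeasurableSet A → X * E A = E A * X
  decomposition : ∃ P N : H →L[ℂ] H,
    HasSpectralIntegral E (spectrum ℂ X) (fun z => z • 1) P ∧
    HasSpectralIntegral E (spectrum ℂ X) (fun z => X - z • 1) N ∧
    X = P + N
  measurable_order : Measurable m
  bounded_order : ∃ M : ℕ, ∀ z ∈ spectrum ℂ X, m z ≤ M
  /-- `((X - λ I) dE(λ)) ^ ℓ = (X - λ I) ^ ℓ dE(λ) = 0` whenever `ℓ ≥ m λ`. -/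
  nilpotent : ∀ l : ℕ,
    HasSpectralIntegral E (spectrum ℂ X ∩ {z | m z ≤ l}) (fun z => (X - z • 1) ^ l) 0

/-- The partial derivative `β^{(q₁,q₂)}(z₁,z₂)`. -/
noncomputable def partialDeriv (q₁ q₂ : ℕ) (β : ℂ → ℂ → ℂ) (z₁ z₂ : ℂ) : ℂ :=
  iteratedDeriv q₁ (fun x => iteratedDeriv q₂ (fun y => β x y) z₂) z₁

/-- `T` is the double operator integral, over `λ₁ ∈ σ(X₁)` and `λ₂ ∈ σ(X₂)`, of
`∑_{q₁ ∈ I₁ λ₁} ∑_{q₂ ∈ I₂ λ₂} β^{(q₁,q₂)}(λ₁,λ₂) / (q₁! q₂!)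
  (X₁ - λ₁ I)^{q₁} dE₁(λ₁) Z (X₂ - λ₂ I)^{q₂} dE₂(λ₂)`:
the norm limit of its Riemann sums over pairs of tagged partitions. -/
def HasDoubleIntegral (X₁ : H →L[ℂ] H) (E₁ : SpectralMeasure H) (I₁ : ℂ → Finset ℕ)
    (X₂ : H →L[ℂ] H) (E₂ : SpectralMeasure H) (I₂ : ℂ → Finset ℕ)
    (β : ℂ → ℂ → ℂ) (Z T : H →L[ℂ] H) : Prop :=
  Tendsto (fun p : TaggedPartition (spectrum ℂ X₁) × TaggedPartition (spectrum ℂ X₂) =>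
      ∑ A ∈ p.1.parts, ∑ B ∈ p.2.parts,
        ∑ q₁ ∈ I₁ (p.1.tag A), ∑ q₂ ∈ I₂ (p.2.tag B),
          (partialDeriv q₁ q₂ β (p.1.tag A) (p.2.tag B) /
              ((q₁.factorial : ℂ) * (q₂.factorial : ℂ))) •
            ((X₁ - p.1.tag A • 1) ^ q₁ * E₁ A * Z * ((X₂ - p.2.tag B • 1) ^ q₂ * E₂ B)))
    (atTop ×ˢ atTop) (𝓝 T)

/-- `T = T_β^{X₁,X₂}(Z)`, the generalized double operator integral: the sum of the
projection-projection, projection-nilpotent, nilpotent-projection and nilpotent-nilpotent double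
integrals, all of which are required to converge. The orders of the nilpotents are `m₁`, `m₂`, and
`Finset.Ico 1 (m λ)` is the range `1 ≤ q ≤ m λ - 1`. -/
def HasGDOI (X₁ : H →L[ℂ] H) (E₁ : SpectralMeasure H) (m₁ : ℂ → ℕ)
    (X₂ : H →L[ℂ] H) (E₂ : SpectralMeasure H) (m₂ : ℂ → ℕ)
    (β : ℂ → ℂ → ℂ) (Z T : H →L[ℂ] H) : Prop :=
  ∃ PP PN NP NN : H →L[ℂ] H,
    HasDoubleIntegral X₁ E₁ (fun _ => {0}) X₂ E₂ (fun _ => {0}) β Z PP ∧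
    HasDoubleIntegral X₁ E₁ (fun _ => {0}) X₂ E₂ (fun z => Finset.Ico 1 (m₂ z)) β Z PN ∧
    HasDoubleIntegral X₁ E₁ (fun z => Finset.Ico 1 (m₁ z)) X₂ E₂ (fun _ => {0}) β Z NP ∧
    HasDoubleIntegral X₁ E₁ (fun z => Finset.Ico 1 (m₁ z))
      X₂ E₂ (fun z => Finset.Ico 1 (m₂ z)) β Z NN ∧
    T = PP + PN + NP + NN

/-- The limits that define the double integrals are unique. -/
theorem HasDoubleIntegral.unique [CompleteSpace H]
    {X₁ X₂ : H →L[ℂ] H} {E₁ E₂ : SpectralMeasure H} {I₁ I₂ : ℂ → Finset ℕ} {β : ℂ → ℂ → ℂ}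
    {Z T T' : H →L[ℂ] H} (h : HasDoubleIntegral X₁ E₁ I₁ X₂ E₂ I₂ β Z T)
    (h' : HasDoubleIntegral X₁ E₁ I₁ X₂ E₂ I₂ β Z T') : T = T' := by
  have := TaggedPartition.nonempty_of_measurableSet (spectrum.isClosed X₁).measurableSet
  have := TaggedPartition.nonempty_of_measurableSet (spectrum.isClosed X₂).measurableSet
  exact tendsto_nhds_unique h h'

/-- The generalized double operator integral has at most one value. -/
theorem HasGDOI.unique [CompleteSpace H]
    {X₁ X₂ : H →L[ℂ] H} {E₁ E₂ : SpectralMeasure H} {m₁ m₂ : ℂ → ℕ} {β : ℂ → ℂ → ℂ}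
    {Z T T' : H →L[ℂ] H} (h : HasGDOI X₁ E₁ m₁ X₂ E₂ m₂ β Z T)
    (h' : HasGDOI X₁ E₁ m₁ X₂ E₂ m₂ β Z T') : T = T' := by
  obtain ⟨a, b, c, d, ha, hb, hc, hd, rfl⟩ := h
  obtain ⟨a', b', c', d', ha', hb', hc', hd', rfl⟩ := h'
  rw [ha.unique ha', hb.unique hb', hc.unique hc', hd.unique hd']

/-- `f(X) = T`, for `f` analytic on a disc about `0` that contains `σ(X)`: the power series of `f`
at `0`, evaluated at `X`, converges in operator norm to `T`. -/
def HasPowerSeriesValue (f : ℂ → ℂ) (X T : H →L[ℂ] H) : Prop :=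
  HasSum (fun n : ℕ => (iteratedDeriv n f 0 / (n.factorial : ℂ)) • X ^ n) T

/-- The first divided difference `f^{[1]}(x₁,x₂) = (f(x₁) - f(x₂)) / (x₁ - x₂)`, for `x₁ ≠ x₂`. -/
noncomputable def dividedDifference (f : ℂ → ℂ) (x₁ x₂ : ℂ) : ℂ := (f x₁ - f x₂) / (x₁ - x₂)

end Integrals

/-!
The divided difference of `f(z) = ∑ a_n z^n` has the expansion
`f^{[1]}(x, y) = ∑_{i,j} a_{i+j+1} x^i y^j`, absolutely convergent on the polydisc of radius `R`, and
off the diagonal its partial derivatives are obtained termwise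
(`hasSum_partialDeriv_dividedDifference`). The Riemann sums of the four double integrals are
therefore series of products `a_{i+j+1} U_i Z V_j`, where `U_i` is a Riemann sum for the part of
`∫ ∑_q (i choose q) λ^(i-q) (X₁ - λ)^q dE₁(λ)` given by `q = 0` or by `1 ≤ q < m λ`, and `V_j` is the
analogue for `X₂` (`binomRiemannSum`, `hasSum_binomRiemannSum_mul`).

Two facts about these single sums suffice. They converge and are bounded by `C ρ^i` for some
`ρ < R`, uniformly in the partition: after expanding `(X - λ)^q` this reduces to bounded Borel
scalar functions, and a spectral measure is uniformly bounded on simple functions, although its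
values need not be self-adjoint (`SpectralMeasure.exists_norm_sum_smul_le`). Moreover the two parts
add up to `X^i` in the limit: the full binomial sum over any partition is exactly `X^i`, and the
exponents `q ≥ m λ` disappear by nilpotency (`IsSpectralDecomposition.tendsto_binomRiemannSum_add`).

By dominated convergence all four double integrals exist, and their sum is
`∑ a_{i+j+1} X₁^i (X₁ Y - Y X₂) X₂^j`. On each diagonal `i + j = n` this telescopes to
`a_{n+1} (X₁^(n+1) Y - Y X₂^(n+1))`, so that the total is `f(X₁) Y - Y f(X₂)`
(`hasSum_dividedDifference_mul`).
-/

/-! ### Uniform boundedness of spectral measures -/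

open MeasureTheory in
/-- A bounded combination of the values of a vector measure on disjoint sets is controlled by its
semivariation: test against a norming functional `ℓ`, for which `∑ |ℓ (μ A)|` is at most the total
variation of `ℓ ∘ μ`. -/
theorem MeasureTheory.VectorMeasure.norm_sum_smul_le_bound {Ω F : Type*} [MeasurableSpace Ω]
    [NormedAddCommGroup F] [NormedSpace ℝ F] (μ : VectorMeasure Ω F) (s : Finset (Set Ω))
    (hd : ∀ A ∈ s, ∀ B ∈ s, A ≠ B → Disjoint A B) (a : Set Ω → ℝ)
    {δ : ℝ} (ha : ∀ A ∈ s, |a A| ≤ δ) (hδ : 0 ≤ δ) :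
    ‖∑ A ∈ s, a A • μ A‖ ≤ δ * μ.bound := by
  obtain ⟨l, hl, hlx⟩ := exists_dual_vector'' ℝ (∑ A ∈ s, a A • μ A)
  have hl' : ‖l‖ₑ ≤ 1 := by
    simpa [enorm_eq_nnnorm, ← NNReal.coe_le_one] using hl
  have h1 : ∑ A ∈ s, ‖μ.mapRange (l : F →+ ℝ) l.continuous A‖ₑ ≤ (μ.bound : ENNReal) := by
    refine (VectorMeasure.le_variation _ MeasurableSet.univ (fun A _ => Set.subset_univ A)
      (fun A hA B hB h => hd A hA B hB h)).trans ?_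
    refine le_trans ?_ (VectorMeasure.semivariation_apply_le_bound (μ := μ) (s := Set.univ))
    exact le_biSup (fun l : StrongDual ℝ F =>
      (μ.mapRange (l : F →+ ℝ) l.continuous).variation Set.univ) hl'
  have h2 : ∑ A ∈ s, |l (μ A)| ≤ μ.bound := by
    have h3 : ((∑ A ∈ s, ‖l (μ A)‖₊ : NNReal) : ENNReal) ≤ μ.bound := by
      push_cast
      exact h1
    have h4 := ENNReal.coe_le_coe.1 h3
    rw [← NNReal.coe_le_coe] at h4
    simpa using h4
  have h5 : ‖∑ A ∈ s, a A • μ A‖ = ∑ A ∈ s, a A * l (μ A) := by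
    have : l (∑ A ∈ s, a A • μ A) = ‖∑ A ∈ s, a A • μ A‖ := by simpa using hlx
    rw [← this, map_sum]
    simp
  rw [h5]
  calc ∑ A ∈ s, a A * l (μ A) ≤ ∑ A ∈ s, δ * |l (μ A)| := by
        refine Finset.sum_le_sum fun A hA => (le_abs_self _).trans ?_
        rw [abs_mul]
        gcongr
        exact ha A hA
    _ = δ * ∑ A ∈ s, |l (μ A)| := by rw [Finset.mul_sum]
    _ ≤ δ * μ.bound := by gcongr

namespace SpectralMeasure

variable {H : Type*} [NormedAddCommGroup H] [InnerProductSpace ℂ H] (E : SpectralMeasure H)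

theorem apply_empty : E ∅ = 0 := by
  ext x
  have h := E.hasSum_iUnion (fun _ => ∅) (fun _ => MeasurableSet.empty)
    (fun _ _ _ => disjoint_bot_left) x
  simpa [summable_const_iff] using h.summable

theorem mul_eq_zero {A B : Set ℂ} (hA : MeasurableSet A) (hB : MeasurableSet B)
    (h : Disjoint A B) : E A * E B = 0 := by
  rw [← E.map_inter A B hA hB, h.inter_eq, E.apply_empty]

theorem mul_self {A : Set ℂ} (hA : MeasurableSet A) : E A * E A = E A := by
  rw [← E.map_inter A A hA hA, Set.inter_self]

open Classical in
/-- The `H`-valued measure `A ↦ E(A) x`, with value `0` on the sets that are not Borel, as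
`VectorMeasure` requires. -/
noncomputable def vectorMeasure (x : H) : MeasureTheory.VectorMeasure ℂ H where
  measureOf' A := if MeasurableSet A then E A x else 0
  empty' := by simp [E.apply_empty]
  not_measurable' A hA := by simp [hA]
  m_iUnion' A hA hd := by
    simpa [hA, MeasurableSet.iUnion hA] using E.hasSum_iUnion A hA hd x

theorem vectorMeasure_apply (x : H) {A : Set ℂ} (hA : MeasurableSet A) :
    E.vectorMeasure x A = E A x := if_pos hA

theorem apply_biUnion (s : Finset (Set ℂ)) (hs : ∀ A ∈ s, MeasurableSet A)
    (hd : ∀ A ∈ s, ∀ B ∈ s, A ≠ B → Disjoint A B) : E (⋃ A ∈ s, A) = ∑ A ∈ s, E A := by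
  ext x
  have h := (E.vectorMeasure x).of_biUnion_finset (s := s) (f := fun A => A)
    (fun A hA B hB h => hd A hA B hB h) hs
  rw [vectorMeasure_apply _ _ (Finset.measurableSet_biUnion s hs)] at h
  rw [h, sum_apply]
  exact Finset.sum_congr rfl fun A hA => E.vectorMeasure_apply x (hs A hA)

/-- A spectral measure is uniformly bounded, even on simple functions: by countable additivity the
measures `E(·) x` have finite semivariation, and the uniform boundedness principle applies. -/
theorem exists_norm_sum_smul_le [CompleteSpace H] : ∃ K : ℝ, 0 < K ∧
    ∀ s : Finset (Set ℂ), (∀ A ∈ s, MeasurableSet A) →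
      (∀ A ∈ s, ∀ B ∈ s, A ≠ B → Disjoint A B) → ∀ (c : Set ℂ → ℂ) (δ : ℝ), 0 ≤ δ →
      (∀ A ∈ s, ‖c A‖ ≤ δ) → ‖∑ A ∈ s, c A • E A‖ ≤ K * δ := by
  let ι := {p : Finset (Set ℂ) × (Set ℂ → ℂ) // (∀ A ∈ p.1, MeasurableSet A) ∧
    (∀ A ∈ p.1, ∀ B ∈ p.1, A ≠ B → Disjoint A B) ∧ ∀ A ∈ p.1, ‖p.2 A‖ ≤ 1}
  obtain ⟨K, hK⟩ := banach_steinhaus (g := fun p : ι => ∑ A ∈ p.1.1, p.1.2 A • E A) (by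
    intro x
    refine ⟨2 * (E.vectorMeasure x).bound, ?_⟩
    rintro ⟨⟨s, c⟩, hs, hd, hc⟩
    have hre := (E.vectorMeasure x).norm_sum_smul_le_bound s hd (fun A => (c A).re) (δ := 1)
      (fun A hA => (Complex.abs_re_le_norm _).trans (hc A hA)) zero_le_one
    have him := (E.vectorMeasure x).norm_sum_smul_le_bound s hd (fun A => (c A).im) (δ := 1)
      (fun A hA => (Complex.abs_im_le_norm _).trans (hc A hA)) zero_le_one
    have h : (∑ A ∈ s, c A • E A) x = ∑ A ∈ s, (c A).re • E.vectorMeasure x A +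
        Complex.I • ∑ A ∈ s, (c A).im • E.vectorMeasure x A := by
      rw [sum_apply, Finset.smul_sum, ← Finset.sum_add_distrib]
      refine Finset.sum_congr rfl fun A hA => ?_
      rw [E.vectorMeasure_apply x (hs A hA), smul_apply]
      conv_lhs => rw [← Complex.re_add_im (c A)]
      rw [add_smul, mul_comm, mul_smul, Complex.coe_smul, Complex.coe_smul]
    dsimp only
    rw [h]
    refine (norm_add_le _ _).trans ?_
    rw [norm_smul, Complex.norm_I]
    linarith)
  refine ⟨max K 1, by positivity, fun s hs hd c δ hδ hc => ?_⟩
  rcases hδ.eq_or_lt with rfl | hδ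
  · rw [Finset.sum_eq_zero fun A hA => by rw [norm_le_zero_iff.1 (hc A hA), zero_smul]]
    simp
  · have h := hK ⟨(s, fun A => (δ : ℂ)⁻¹ * c A), hs, hd, fun A hA => by
      rw [norm_mul, norm_inv, Complex.norm_real, Real.norm_of_nonneg hδ.le, inv_mul_le_one₀ hδ]
      exact hc A hA⟩
    have h' : ∑ A ∈ s, c A • E A = (δ : ℂ) • ∑ A ∈ s, ((δ : ℂ)⁻¹ * c A) • E A := by
      rw [Finset.smul_sum]
      refine Finset.sum_congr rfl fun A _ => ?_
      rw [smul_smul, mul_inv_cancel_left₀ (by exact_mod_cast hδ.ne')]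
    rw [h', norm_smul, Complex.norm_real, Real.norm_of_nonneg hδ.le, mul_comm]
    gcongr
    exact h.trans (le_max_left _ _)

end SpectralMeasure

/-! ### Partitions of a Borel set -/

namespace TaggedPartition

variable {S : Set ℂ}

theorem subset (P : TaggedPartition S) {A : Set ℂ} (hA : A ∈ P.parts) : A ⊆ S := by
  rw [← P.union_eq]
  exact Set.subset_biUnion_of_mem (u := fun A => A) hA

theorem tag_mem_set (P : TaggedPartition S) {A : Set ℂ} (hA : A ∈ P.parts) : P.tag A ∈ S :=
  P.subset hA (P.tag_mem A hA)

theorem exists_mem_parts (P : TaggedPartition S) {z : ℂ} (hz : z ∈ S) : ∃ A ∈ P.parts, z ∈ A := by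
  rw [← P.union_eq] at hz
  simpa using hz

theorem eq_of_mem_of_mem (P : TaggedPartition S) {A B : Set ℂ} (hA : A ∈ P.parts)
    (hB : B ∈ P.parts) {z : ℂ} (hzA : z ∈ A) (hzB : z ∈ B) : A = B := by
  by_contra h
  exact Set.disjoint_left.1 (P.disjoint A hA B hB h) hzA hzB

open Classical in
/-- Finitely many Borel pieces that are nonempty, disjoint and exhaust `S` can be tagged. -/
theorem exists_parts_eq (s : Finset (Set ℂ)) (hm : ∀ A ∈ s, MeasurableSet A)
    (hd : ∀ A ∈ s, ∀ B ∈ s, A ≠ B → Disjoint A B) (hu : ⋃ A ∈ s, A = S)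
    (hn : ∀ A ∈ s, A.Nonempty) : ∃ P : TaggedPartition S, P.parts = s :=
  ⟨⟨s, hm, hd, hu, fun A => if h : A.Nonempty then h.some else 0, fun A hA => by
    simp only [hn A hA, dif_pos]; exact (hn A hA).some_mem⟩, rfl⟩

open Classical in
theorem exists_forall_eq_of_finite_image (hS : MeasurableSet S) {ι : Type*} (g : ℂ → ι)
    (hg : ∀ i, MeasurableSet (g ⁻¹' {i})) (hfin : (g '' S).Finite) :
    ∃ P : TaggedPartition S, ∀ A ∈ P.parts, ∀ x ∈ A, ∀ y ∈ A, g x = g y := by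
  obtain ⟨P, hP⟩ := exists_parts_eq (S := S)
    (hfin.toFinset.image fun i => S ∩ g ⁻¹' {i}) (by
      simp only [Finset.mem_image]
      rintro _ ⟨i, -, rfl⟩
      exact hS.inter (hg i)) (by
      simp only [Finset.mem_image]
      rintro _ ⟨i, -, rfl⟩ _ ⟨j, -, rfl⟩ hij
      have : i ≠ j := fun h => hij (by rw [h])
      refine Set.disjoint_left.2 fun z hz hz' => this ?_
      rw [← hz.2, ← hz'.2]) (by
      ext z
      simpa using fun hz => ⟨z, hz, rfl⟩) (by
      simp only [Finset.mem_image, Set.Finite.mem_toFinset]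
      rintro _ ⟨i, ⟨z, hz, rfl⟩, rfl⟩
      exact ⟨z, hz, rfl⟩)
  refine ⟨P, fun A hA x hx y hy => ?_⟩
  rw [hP, Finset.mem_image] at hA
  obtain ⟨i, -, rfl⟩ := hA
  rw [hx.2, hy.2]

/-- A bounded Borel function is nearly constant on the pieces of some finite Borel partition. -/
theorem exists_forall_norm_sub_le (hS : MeasurableSet S) {φ : ℂ → ℂ} (hφ : Measurable φ) {C : ℝ}
    (hC : ∀ z ∈ S, ‖φ z‖ ≤ C) {ε : ℝ} (hε : 0 < ε) :
    ∃ P : TaggedPartition S, ∀ A ∈ P.parts, ∀ x ∈ A, ∀ y ∈ A, ‖φ x - φ y‖ ≤ 2 * ε := by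
  obtain ⟨P, hP⟩ := exists_forall_eq_of_finite_image hS
    (fun z => (⌊(φ z).re / ε⌋, ⌊(φ z).im / ε⌋)) (fun i => by
      have : Measurable (fun z => (⌊(φ z).re / ε⌋, ⌊(φ z).im / ε⌋)) :=
        (((Complex.measurable_re.comp hφ).div_const ε).floor).prodMk
          (((Complex.measurable_im.comp hφ).div_const ε).floor)
      exact this (measurableSet_singleton i)) (by
      refine (Set.finite_Icc ((⌊-C / ε⌋, ⌊-C / ε⌋) : ℤ × ℤ) (⌊C / ε⌋, ⌊C / ε⌋)).subset ?_
      rintro _ ⟨z, hz, rfl⟩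
      have hre := abs_le.1 ((Complex.abs_re_le_norm _).trans (hC z hz))
      have him := abs_le.1 ((Complex.abs_im_le_norm _).trans (hC z hz))
      refine ⟨⟨?_, ?_⟩, ⟨?_, ?_⟩⟩ <;> dsimp only <;> gcongr
      exacts [hre.1, him.1, hre.2, him.2])
  have key : ∀ a b : ℝ, ⌊a / ε⌋ = ⌊b / ε⌋ → |a - b| ≤ ε := fun a b h => by
    have h1 := Int.abs_sub_lt_one_of_floor_eq_floor h
    rw [← sub_div, abs_div, abs_of_pos hε, div_lt_one hε] at h1
    exact h1.le
  refine ⟨P, fun A hA x hx y hy => ?_⟩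
  have h := hP A hA x hx y hy
  simp only [Prod.mk.injEq] at h
  refine (Complex.norm_le_abs_re_add_abs_im _).trans ?_
  have h1 := key _ _ h.1
  have h2 := key _ _ h.2
  simp only [Complex.sub_re, Complex.sub_im]
  linarith

end TaggedPartition

section Restriction

variable {H : Type*} [NormedAddCommGroup H] [InnerProductSpace ℂ H] {E : SpectralMeasure H}

open Classical in
/-- An integral over a Borel subset `V` of `S` is the integral over `S` of the function cut off
outside `V`: a partition of `S` that is fine enough restricts to a partition of `V`. -/
theorem HasSpectralIntegral.indicator {V S : Set ℂ} {G : ℂ → (H →L[ℂ] H)} {T : H →L[ℂ] H}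
    (h : HasSpectralIntegral E V G T) (hV : MeasurableSet V) (hS : MeasurableSet S) (hVS : V ⊆ S) :
    HasSpectralIntegral E S (V.indicator G) T := by
  have := TaggedPartition.nonempty_of_measurableSet hV
  have := TaggedPartition.nonempty_of_measurableSet hS
  refine tendsto_def.2 fun U hU => ?_
  obtain ⟨P₀, hP₀⟩ := mem_atTop_sets.1 (tendsto_def.1 h U hU)
  -- The pieces of `P₀` together with `S \ V`, which has to be left out if it is empty.
  obtain ⟨P₁, hP₁⟩ := TaggedPartition.exists_parts_eq (S := S)
    (if (S \ V).Nonempty then insert (S \ V) P₀.parts else P₀.parts) (by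
      split_ifs
      · simpa using ⟨hS.diff hV, P₀.measurableSet⟩
      · exact P₀.measurableSet) (by
      split_ifs
      · have hdis : ∀ A ∈ P₀.parts, Disjoint A (S \ V) := fun A hA =>
          disjoint_sdiff_self_right.mono_left (P₀.subset hA)
        intro A hA B hB hAB
        rcases Finset.mem_insert.1 hA with rfl | hA <;> rcases Finset.mem_insert.1 hB with rfl | hB
        · exact absurd rfl hAB
        · exact (hdis B hB).symm
        · exact hdis A hA
        · exact P₀.disjoint A hA B hB hAB
      · exact P₀.disjoint) (by
      split_ifs with hne
      · rw [Finset.set_biUnion_insert, P₀.union_eq, Set.sdiff_union_of_subset hVS]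
      · rw [P₀.union_eq]
        exact hVS.antisymm (Set.sdiff_eq_empty.1 (Set.not_nonempty_iff_eq_empty.1 hne))) (by
      split_ifs with hne
      · simpa using ⟨hne, fun A hA => ⟨_, P₀.tag_mem A hA⟩⟩
      · exact fun A hA => ⟨_, P₀.tag_mem A hA⟩)
  refine mem_atTop_sets.2 ⟨P₁, fun P hP => ?_⟩
  have hdich : ∀ A ∈ P.parts, (∃ B ∈ P₀.parts, A ⊆ B) ∨ A ⊆ S \ V := by
    intro A hA
    obtain ⟨B, hB, hAB⟩ := hP A hA
    rw [hP₁] at hB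
    split_ifs at hB
    · rcases Finset.mem_insert.1 hB with rfl | hB
      exacts [Or.inr hAB, Or.inl ⟨B, hB, hAB⟩]
    · exact Or.inl ⟨B, hB, hAB⟩
  have hsub : ∀ A ∈ P.parts, ∀ z ∈ A, z ∈ V → ∃ B ∈ P₀.parts, A ⊆ B := fun A hA z hz hzV =>
    (hdich A hA).resolve_right fun h => (h hz).2 hzV
  have hmem : ∀ A, A ∈ P.parts.filter (fun A => P.tag A ∈ V) ↔ A ∈ P.parts ∧ P.tag A ∈ V :=
    fun A => Finset.mem_filter
  let Q : TaggedPartition V :=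
    { parts := P.parts.filter (fun A => P.tag A ∈ V)
      measurableSet := fun A hA => P.measurableSet A ((hmem A).1 hA).1
      disjoint := fun A hA B hB => P.disjoint A ((hmem A).1 hA).1 B ((hmem B).1 hB).1
      union_eq := by
        ext z
        simp only [Set.mem_iUnion, exists_prop, Finset.mem_filter]
        constructor
        · rintro ⟨A, ⟨hA, hAV⟩, hz⟩
          obtain ⟨B, hB, hAB⟩ := hsub A hA _ (P.tag_mem A hA) hAV
          exact P₀.subset hB (hAB hz)
        · intro hz
          obtain ⟨A, hA, hzA⟩ := P.exists_mem_parts (hVS hz)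
          obtain ⟨B, hB, hAB⟩ := hsub A hA z hzA hz
          exact ⟨A, ⟨hA, P₀.subset hB (hAB (P.tag_mem A hA))⟩, hzA⟩
      tag := P.tag
      tag_mem := fun A hA => P.tag_mem A ((hmem A).1 hA).1 }
  have hQ : P₀ ≤ Q := fun A hA =>
    hsub A ((hmem A).1 hA).1 _ (P.tag_mem A ((hmem A).1 hA).1) ((hmem A).1 hA).2
  have hQU := hP₀ Q hQ
  have hsum : ∑ A ∈ P.parts, V.indicator G (P.tag A) * E A =
      ∑ A ∈ Q.parts, G (Q.tag A) * E A := by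
    change _ = ∑ A ∈ P.parts.filter (fun A => P.tag A ∈ V), G (P.tag A) * E A
    rw [Finset.sum_filter]
    refine Finset.sum_congr rfl fun A _ => ?_
    by_cases hA : P.tag A ∈ V <;> simp [hA]
  simp only [Set.mem_preimage] at hQU ⊢
  rwa [hsum]

end Restriction

/-! ### Riemann sums of a single spectral integral -/

section RiemannSums

variable {H : Type*} [NormedAddCommGroup H] [InnerProductSpace ℂ H] {S : Set ℂ}

/-- The Riemann sum `∑ φ(tag A) E(A)` of a scalar function. -/
noncomputable def riemannSum (E : SpectralMeasure H) (φ : ℂ → ℂ) (P : TaggedPartition S) :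
    H →L[ℂ] H :=
  ∑ A ∈ P.parts, φ (P.tag A) • E A

/-- The Riemann sum `∑ φ(tag A) (X - tag A)^q E(A)`. -/
noncomputable def powRiemannSum (E : SpectralMeasure H) (X : H →L[ℂ] H) (φ : ℂ → ℂ) (q : ℕ)
    (P : TaggedPartition S) : H →L[ℂ] H :=
  ∑ A ∈ P.parts, φ (P.tag A) • ((X - P.tag A • 1) ^ q * E A)

/-- Expanding `(X - λ)^q` reduces the sums with operator coefficients to scalar ones. -/
theorem powRiemannSum_eq (E : SpectralMeasure H) (X : H →L[ℂ] H) (φ : ℂ → ℂ) (q : ℕ)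
    (P : TaggedPartition S) : powRiemannSum E X φ q P = ∑ k ∈ Finset.range (q + 1),
      (q.choose k : ℂ) • (X ^ k * riemannSum E (fun z => φ z * (-z) ^ (q - k)) P) := by
  simp only [powRiemannSum, riemannSum, Finset.mul_sum, Finset.smul_sum]
  rw [Finset.sum_comm]
  refine Finset.sum_congr rfl fun A _ => ?_
  have hc : Commute X ((-P.tag A) • (1 : H →L[ℂ] H)) := (Commute.one_right X).smul_right _
  rw [sub_eq_add_neg, ← neg_smul, hc.add_pow, Finset.sum_mul, Finset.smul_sum]
  refine Finset.sum_congr rfl fun k _ => ?_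
  rw [smul_pow, one_pow, ← nsmul_eq_mul', ← Nat.cast_smul_eq_nsmul ℂ]
  simp only [mul_smul_comm, smul_mul_assoc, mul_one, smul_smul]
  congr 1
  ring

theorem riemannSum_mul_powRiemannSum {E : SpectralMeasure H} {X : H →L[ℂ] H}
    (hX : ∀ A, MeasurableSet A → X * E A = E A * X) (φ ψ : ℂ → ℂ) (q : ℕ)
    (P : TaggedPartition S) : riemannSum E φ P * powRiemannSum E X ψ q P =
      powRiemannSum E X (fun z => φ z * ψ z) q P := by
  simp only [riemannSum, powRiemannSum, Finset.sum_mul, Finset.mul_sum]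
  refine Finset.sum_congr rfl fun A hA => ?_
  have hA' := P.measurableSet A hA
  have hc : Commute (E A) ((X - P.tag A • 1) ^ q) :=
    (Commute.sub_right (hX A hA').symm ((Commute.one_right _).smul_right _)).pow_right q
  -- Distinct pieces are disjoint, so that only the diagonal terms survive.
  rw [Finset.sum_eq_single A]
  · rw [smul_mul_smul_comm, ← mul_assoc, hc.eq, mul_assoc, E.mul_self hA']
  · intro B hB hBA
    have hB' := P.measurableSet B hB
    have hc : Commute (E B) ((X - P.tag A • 1) ^ q) :=
      (Commute.sub_right (hX B hB').symm ((Commute.one_right _).smul_right _)).pow_right q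
    rw [smul_mul_smul_comm, ← mul_assoc, hc.eq, mul_assoc,
      E.mul_eq_zero hB' hA' (P.disjoint B hB A hA hBA), mul_zero, smul_zero]
  · exact fun h => absurd hA h

open Classical in
/-- If `φ` oscillates by at most `δ` on the pieces of `P`, then passing to a refinement of `P`
changes the Riemann sum by at most `K δ`, for a constant `K` that depends on `E` only. -/
theorem norm_riemannSum_sub_le {E : SpectralMeasure H} {K : ℝ}
    (hK : ∀ s : Finset (Set ℂ), (∀ A ∈ s, MeasurableSet A) →
      (∀ A ∈ s, ∀ B ∈ s, A ≠ B → Disjoint A B) → ∀ (c : Set ℂ → ℂ) (δ : ℝ), 0 ≤ δ →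
      (∀ A ∈ s, ‖c A‖ ≤ δ) → ‖∑ A ∈ s, c A • E A‖ ≤ K * δ)
    {φ : ℂ → ℂ} {P Q : TaggedPartition S} (hPQ : P ≤ Q) {δ : ℝ} (hδ : 0 ≤ δ)
    (hφ : ∀ A ∈ P.parts, ∀ x ∈ A, ∀ y ∈ A, ‖φ x - φ y‖ ≤ δ) :
    ‖riemannSum E φ P - riemannSum E φ Q‖ ≤ K * δ := by
  choose! p hp hsub using hPQ
  -- `E(A)` is the sum of `E(B)` over the pieces `B` of `Q` inside `A`;
  -- this writes both Riemann sums over the pieces of `Q`.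
  have h1 : riemannSum E φ P = ∑ B ∈ Q.parts, φ (P.tag (p B)) • E B := by
    rw [← Finset.sum_fiberwise_of_maps_to hp]
    refine Finset.sum_congr rfl fun A hA => ?_
    have hu : A = ⋃ B ∈ Q.parts.filter (fun B => p B = A), B := by
      ext z
      simp only [Set.mem_iUnion, exists_prop, Finset.mem_filter]
      constructor
      · intro hz
        obtain ⟨B, hB, hzB⟩ := Q.exists_mem_parts (P.subset hA hz)
        exact ⟨B, ⟨hB, P.eq_of_mem_of_mem (hp B hB) hA (hsub B hB hzB) hz⟩, hzB⟩
      · rintro ⟨B, ⟨hB, rfl⟩, hz⟩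
        exact hsub B hB hz
    conv_lhs => rw [hu]
    rw [E.apply_biUnion _ (fun B hB => Q.measurableSet B (Finset.mem_filter.1 hB).1)
      (fun B hB C hC => Q.disjoint B (Finset.mem_filter.1 hB).1 C (Finset.mem_filter.1 hC).1),
      ← hu, Finset.smul_sum]
    refine Finset.sum_congr rfl fun B hB => ?_
    rw [(Finset.mem_filter.1 hB).2]
  rw [h1, riemannSum, ← Finset.sum_sub_distrib]
  simp only [← sub_smul]
  exact hK _ Q.measurableSet Q.disjoint (fun B => φ (P.tag (p B)) - φ (Q.tag B)) δ hδ fun B hB =>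
    hφ _ (hp B hB) _ (P.tag_mem _ (hp B hB)) _ (hsub B hB (Q.tag_mem B hB))

/-- The inequality holds for `k = 0` on the zero space too, where `‖1‖ = 0`. -/
theorem ContinuousLinearMap.opNorm_pow_le (X : H →L[ℂ] H) : ∀ k : ℕ, ‖X ^ k‖ ≤ ‖X‖ ^ k
  | 0 => by
    rw [pow_zero, pow_zero]
    exact ContinuousLinearMap.norm_id_le
  | k + 1 => norm_pow_le' X k.succ_pos

variable [CompleteSpace H]

/-- Bounded Borel functions are integrable against a spectral measure. -/
theorem exists_tendsto_riemannSum (E : SpectralMeasure H) (hS : MeasurableSet S) {φ : ℂ → ℂ}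
    (hφ : Measurable φ) {C : ℝ} (hC : ∀ z ∈ S, ‖φ z‖ ≤ C) :
    ∃ T, Tendsto (fun P : TaggedPartition S => riemannSum E φ P) atTop (𝓝 T) := by
  obtain ⟨K, hK0, hK⟩ := E.exists_norm_sum_smul_le
  have := TaggedPartition.nonempty_of_measurableSet hS
  rw [← cauchy_map_iff_exists_tendsto, Metric.cauchy_iff]
  refine ⟨inferInstance, fun ε hε => ?_⟩
  have hη : 0 < ε / (8 * K) := by positivity
  obtain ⟨P, hP⟩ := TaggedPartition.exists_forall_norm_sub_le hS hφ hC hη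
  have hclose : ∀ Q, P ≤ Q → ‖riemannSum E φ P - riemannSum E φ Q‖ ≤ ε / 4 := fun Q hQ => by
    refine (norm_riemannSum_sub_le hK hQ (by positivity) hP).trans_eq ?_
    field_simp
    norm_num
  refine ⟨_, image_mem_map (Ici_mem_atTop P), ?_⟩
  rintro _ ⟨Q, hQ, rfl⟩ _ ⟨Q', hQ', rfl⟩
  rw [dist_eq_norm, ← sub_sub_sub_cancel_left _ _ (riemannSum E φ P)]
  refine (norm_sub_le _ _).trans_lt ?_
  linarith [hclose Q hQ, hclose Q' hQ']

theorem exists_tendsto_powRiemannSum (E : SpectralMeasure H) (X : H →L[ℂ] H)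
    (hS : MeasurableSet S) {φ : ℂ → ℂ} (hφ : Measurable φ) {C r : ℝ} (hC : ∀ z ∈ S, ‖φ z‖ ≤ C)
    (hr : ∀ z ∈ S, ‖z‖ ≤ r) (q : ℕ) :
    ∃ T, Tendsto (fun P : TaggedPartition S => powRiemannSum E X φ q P) atTop (𝓝 T) := by
  have h : ∀ k, ∃ T, Tendsto (fun P : TaggedPartition S =>
      riemannSum E (fun z => φ z * (-z) ^ (q - k)) P) atTop (𝓝 T) := fun k =>
    exists_tendsto_riemannSum E hS (hφ.mul (measurable_id.neg.pow_const _))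
      (C := C * r ^ (q - k)) fun z hz => by
        rw [norm_mul, norm_pow, norm_neg]
        gcongr
        exacts [(norm_nonneg _).trans (hC z hz), hC z hz, hr z hz]
  choose T hT using h
  simp only [powRiemannSum_eq]
  exact ⟨_, tendsto_finsetSum _ fun k _ => ((hT k).const_mul _).const_smul _⟩

/-- The Riemann sums of `φ(λ) (X - λ)^q` are bounded uniformly in the partition. -/
theorem exists_norm_powRiemannSum_le (E : SpectralMeasure H) (X : H →L[ℂ] H) {r : ℝ} (hr0 : 0 ≤ r)
    (hr : ∀ z ∈ S, ‖z‖ ≤ r) : ∃ K : ℝ, 0 < K ∧ ∀ (φ : ℂ → ℂ) (C : ℝ), 0 ≤ C →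
      (∀ z ∈ S, ‖φ z‖ ≤ C) → ∀ (q : ℕ) (P : TaggedPartition S),
      ‖powRiemannSum E X φ q P‖ ≤ K * (‖X‖ + r) ^ q * C := by
  obtain ⟨K, hK0, hK⟩ := E.exists_norm_sum_smul_le
  refine ⟨K, hK0, fun φ C hC0 hC q P => ?_⟩
  rw [powRiemannSum_eq, add_pow, Finset.mul_sum, Finset.sum_mul]
  refine norm_sum_le_of_le _ fun k _ => ?_
  have h : ‖riemannSum E (fun z => φ z * (-z) ^ (q - k)) P‖ ≤ K * (C * r ^ (q - k)) :=
    hK _ P.measurableSet P.disjoint _ _ (by positivity) fun A hA => by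
      rw [norm_mul, norm_pow, norm_neg]
      gcongr
      exacts [hC _ (P.tag_mem_set hA), hr _ (P.tag_mem_set hA)]
  rw [norm_smul, Complex.norm_natCast]
  calc (q.choose k : ℝ) * ‖X ^ k * riemannSum E (fun z => φ z * (-z) ^ (q - k)) P‖
      ≤ q.choose k * (‖X‖ ^ k * (K * (C * r ^ (q - k)))) := by
        gcongr
        exact (norm_mul_le _ _).trans (mul_le_mul (X.opNorm_pow_le k) h (norm_nonneg _)
          (by positivity))
    _ = K * (‖X‖ ^ k * r ^ (q - k) * q.choose k) * C := by ring

end RiemannSums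

/-! ### The binomial expansion of `X ^ i` -/

section BinomialSums

variable {H : Type*} [NormedAddCommGroup H] [InnerProductSpace ℂ H] {S : Set ℂ}

/-- The part, given by the exponents `q ∈ I λ`, of the Riemann sum of the binomial expansion
`∑_q (i choose q) λ^(i - q) (X - λ)^q dE(λ)` of `X^i dE(λ)`. -/
noncomputable def binomRiemannSum (E : SpectralMeasure H) (X : H →L[ℂ] H) (I : ℂ → Finset ℕ)
    (i : ℕ) (P : TaggedPartition S) : H →L[ℂ] H :=
  ∑ A ∈ P.parts, ∑ q ∈ I (P.tag A),
    ((i.choose q : ℂ) * P.tag A ^ (i - q)) • ((X - P.tag A • 1) ^ q * E A)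

theorem binomRiemannSum_eq (E : SpectralMeasure H) (X : H →L[ℂ] H) {I : ℂ → Finset ℕ} {i M : ℕ}
    (hM : ∀ z ∈ S, ∀ q ∈ I z, q < M ∨ i < q) (P : TaggedPartition S) :
    binomRiemannSum E X I i P = ∑ q ∈ Finset.range M,
      powRiemannSum E X (fun z => if q ∈ I z then (i.choose q : ℂ) * z ^ (i - q) else 0) q P := by
  simp only [binomRiemannSum, powRiemannSum]
  rw [Finset.sum_comm]
  refine Finset.sum_congr rfl fun A hA => ?_
  simp only [ite_smul, zero_smul]
  rw [Finset.sum_ite_mem]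
  refine (Finset.sum_subset Finset.inter_subset_right fun q hq hq' => ?_).symm
  have hiq : i < q := (hM _ (P.tag_mem_set hA) q hq).resolve_left fun h =>
    hq' (Finset.mem_inter.2 ⟨Finset.mem_range.2 h, hq⟩)
  rw [Nat.choose_eq_zero_of_lt hiq, Nat.cast_zero, zero_mul, zero_smul]

theorem choose_mul_pow_le {r s : ℝ} (hr : 0 ≤ r) (hs : 0 < s) (i q : ℕ) :
    i.choose q * r ^ (i - q) ≤ (s ^ q)⁻¹ * (r + s) ^ i := by
  rw [← div_eq_inv_mul, le_div_iff₀ (by positivity)]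
  rcases le_or_gt q i with h | h
  · rw [add_comm r s, add_pow]
    refine le_trans (le_of_eq ?_) (Finset.single_le_sum (fun k _ => by positivity)
      (Finset.mem_range_succ_iff.2 h))
    ring
  · rw [Nat.choose_eq_zero_of_lt h]
    simp only [Nat.cast_zero, zero_mul]
    positivity

theorem measurable_ite_mem_choose {I : ℂ → Finset ℕ} (hI : ∀ q, MeasurableSet {z | q ∈ I z})
    (i q : ℕ) : Measurable fun z : ℂ => if q ∈ I z then (i.choose q : ℂ) * z ^ (i - q) else 0 :=
  Measurable.ite (hI q) ((measurable_id.pow_const _).const_mul _) measurable_const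

theorem norm_ite_choose_le {p : Prop} [Decidable p] {z : ℂ} {r : ℝ} (hz : ‖z‖ ≤ r) (i q : ℕ) :
    ‖if p then (i.choose q : ℂ) * z ^ (i - q) else 0‖ ≤ i.choose q * r ^ (i - q) := by
  have hr : 0 ≤ r := (norm_nonneg _).trans hz
  split_ifs
  · rw [norm_mul, norm_pow, Complex.norm_natCast]
    gcongr
  · rw [norm_zero]
    positivity

theorem IsSpectralDecomposition.pow_eq_sum_powRiemannSum {X : H →L[ℂ] H} {E : SpectralMeasure H}
    {m : ℂ → ℕ} (h : IsSpectralDecomposition X E m) (i : ℕ)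
    (P : TaggedPartition (spectrum ℂ X)) : X ^ i = ∑ q ∈ Finset.range (i + 1),
      powRiemannSum E X (fun z => (i.choose q : ℂ) * z ^ (i - q)) q P := by
  have h1 : (1 : H →L[ℂ] H) = ∑ A ∈ P.parts, E A := by
    rw [← E.apply_biUnion _ P.measurableSet P.disjoint, P.union_eq, h.measure_spectrum]
  conv_lhs => rw [← mul_one (X ^ i), h1, Finset.mul_sum]
  simp only [powRiemannSum]
  rw [Finset.sum_comm]
  refine Finset.sum_congr rfl fun A _ => ?_
  have hc : Commute (X - P.tag A • 1) (P.tag A • (1 : H →L[ℂ] H)) :=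
    (Commute.one_right _).smul_right _
  conv_lhs => rw [← sub_add_cancel X (P.tag A • 1), hc.add_pow, Finset.sum_mul]
  refine Finset.sum_congr rfl fun q _ => ?_
  rw [smul_pow, one_pow, ← nsmul_eq_mul', ← Nat.cast_smul_eq_nsmul ℂ]
  simp only [mul_smul_comm, smul_mul_assoc, mul_one, smul_smul]

variable [CompleteSpace H]

theorem exists_tendsto_binomRiemannSum (E : SpectralMeasure H) (X : H →L[ℂ] H)
    (hS : MeasurableSet S) {I : ℂ → Finset ℕ} (hI : ∀ q, MeasurableSet {z | q ∈ I z}) {M : ℕ}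
    (hM : ∀ z ∈ S, ∀ q ∈ I z, q < M) {r : ℝ} (hr : ∀ z ∈ S, ‖z‖ ≤ r) (i : ℕ) :
    ∃ T, Tendsto (fun P : TaggedPartition S => binomRiemannSum E X I i P) atTop (𝓝 T) := by
  choose T hT using fun q => exists_tendsto_powRiemannSum E X hS (measurable_ite_mem_choose hI i q)
    (fun z hz => norm_ite_choose_le (hr z hz) i q) hr q
  simp only [binomRiemannSum_eq E X fun z hz q hq => Or.inl (hM z hz q hq)]
  exact ⟨_, tendsto_finsetSum _ fun q _ => hT q⟩

/-- The binomial Riemann sums of degree `i` grow at most like `(r + s)^i`, for every `s > 0`, when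
`S` lies in the disc of radius `r`. -/
theorem exists_norm_binomRiemannSum_le (E : SpectralMeasure H) (X : H →L[ℂ] H)
    {I : ℂ → Finset ℕ} {M : ℕ} (hM : ∀ z ∈ S, ∀ q ∈ I z, q < M) {r s : ℝ} (hr0 : 0 ≤ r)
    (hr : ∀ z ∈ S, ‖z‖ ≤ r) (hs : 0 < s) : ∃ C : ℝ, 0 ≤ C ∧
      ∀ (i : ℕ) (P : TaggedPartition S), ‖binomRiemannSum E X I i P‖ ≤ C * (r + s) ^ i := by
  obtain ⟨K, hK0, hK⟩ := exists_norm_powRiemannSum_le E X hr0 hr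
  refine ⟨∑ q ∈ Finset.range M, K * (‖X‖ + r) ^ q * (s ^ q)⁻¹, by positivity, fun i P => ?_⟩
  rw [binomRiemannSum_eq E X fun z hz q hq => Or.inl (hM z hz q hq), Finset.sum_mul]
  refine norm_sum_le_of_le _ fun q _ => ?_
  refine (hK _ _ (by positivity) (fun z hz => norm_ite_choose_le (hr z hz) i q) q P).trans ?_
  rw [mul_assoc _ (s ^ q)⁻¹]
  exact mul_le_mul_of_nonneg_left (choose_mul_pow_le hr0 hs i q) (by positivity)

namespace IsSpectralDecomposition

variable {X : H →L[ℂ] H} {E : SpectralMeasure H} {m : ℂ → ℕ}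

/-- Nilpotency also holds with a bounded Borel weight: a Riemann sum with weight `φ` is the
product of the Riemann sums of `φ` and of the unweighted integrand. -/
theorem tendsto_powRiemannSum_zero (h : IsSpectralDecomposition X E m) {φ : ℂ → ℂ}
    (hφ : Measurable φ) {C : ℝ} (hC : ∀ z ∈ spectrum ℂ X, ‖φ z‖ ≤ C) (q : ℕ) :
    Tendsto (fun P : TaggedPartition (spectrum ℂ X) =>
      powRiemannSum E X (fun z => if m z ≤ q then φ z else 0) q P) atTop (𝓝 0) := by
  have hS := (spectrum.isClosed (𝕜 := ℂ) X).measurableSet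
  have h1 := (h.nilpotent q).indicator (hS.inter (h.measurable_order measurableSet_Iic)) hS
    Set.inter_subset_left
  obtain ⟨T, hT⟩ := exists_tendsto_riemannSum E hS hφ hC
  have h2 := hT.mul h1
  rw [mul_zero] at h2
  refine h2.congr fun P => ?_
  have h3 : ∑ A ∈ P.parts, (spectrum ℂ X ∩ {z | m z ≤ q}).indicator
      (fun z => (X - z • 1) ^ q) (P.tag A) * E A =
      powRiemannSum E X (fun z => if m z ≤ q then 1 else 0) q P := by
    refine Finset.sum_congr rfl fun A hA => ?_
    have := P.tag_mem_set hA
    by_cases hm : m (P.tag A) ≤ q <;> simp [this, hm]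
  rw [h3, riemannSum_mul_powRiemannSum h.commute]
  simp only [mul_ite, mul_one, mul_zero]

/-- The scalar part and the nilpotent part of `∫ λ^i dE` together recover `X^i`: for every
partition the full binomial sum is exactly `X^i`, and the exponents `q ≥ m λ` do not contribute in
the limit. -/
theorem tendsto_binomRiemannSum_add (h : IsSpectralDecomposition X E m) (i : ℕ) :
    Tendsto (fun P : TaggedPartition (spectrum ℂ X) =>
      binomRiemannSum E X (fun _ => {0}) i P +
        binomRiemannSum E X (fun z => Finset.Ico 1 (m z)) i P) atTop (𝓝 (X ^ i)) := by
  obtain ⟨r, hr⟩ := (spectrum.isCompact (𝕜 := ℂ) X).isBounded.exists_norm_le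
  have hlim : Tendsto (fun P : TaggedPartition (spectrum ℂ X) => X ^ i -
      ∑ q ∈ Finset.range (i + 1), powRiemannSum E X (fun z => if m z ≤ q then
        (if q ≠ 0 then (i.choose q : ℂ) * z ^ (i - q) else 0) else 0) q P) atTop
      (𝓝 (X ^ i - ∑ q ∈ Finset.range (i + 1), 0)) :=
    tendsto_const_nhds.sub <| tendsto_finsetSum _ fun q _ => h.tendsto_powRiemannSum_zero
      (Measurable.ite (MeasurableSet.const _) ((measurable_id.pow_const _).const_mul _)
        measurable_const) (fun z hz => norm_ite_choose_le (hr z hz) i q) q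
  rw [Finset.sum_const_zero, sub_zero] at hlim
  refine hlim.congr fun P => ?_
  rw [binomRiemannSum_eq (M := i + 1) E X (fun z _ q _ => by omega),
    binomRiemannSum_eq (M := i + 1) E X (fun z _ q _ => by omega)]
  conv_lhs => rw [h.pow_eq_sum_powRiemannSum i P]
  rw [← Finset.sum_sub_distrib, ← Finset.sum_add_distrib]
  refine Finset.sum_congr rfl fun q _ => ?_
  simp only [powRiemannSum]
  rw [← Finset.sum_sub_distrib, ← Finset.sum_add_distrib]
  refine Finset.sum_congr rfl fun A _ => ?_
  rw [← sub_smul, ← add_smul]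
  congr 1
  simp only [Finset.mem_singleton, Finset.mem_Ico]
  split_ifs <;> first | omega | simp

end IsSpectralDecomposition

end BinomialSums

/-! ### Power series of the divided difference -/

section DividedDifference

/-- For `f(z) = ∑ a_n z^n` the divided difference is `∑ a_{i+j+1} x^i y^j`. Here `x` and `y` may be
elements of a Banach algebra: on the diagonal `i + j = n` the terms telescope to
`x^(n+1) w - w y^(n+1)`. -/
theorem hasSum_dividedDifference_mul {𝔸 : Type*} [NormedRing 𝔸] [NormedAlgebra ℂ 𝔸]
    [CompleteSpace 𝔸] {a : ℕ → ℂ} {x y fx fy : 𝔸} (w : 𝔸)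
    (hx : HasSum (fun n => a n • x ^ n) fx) (hy : HasSum (fun n => a n • y ^ n) fy)
    (hs : Summable fun p : ℕ × ℕ =>
      a (p.1 + p.2 + 1) • (x ^ p.1 * (x * w - w * y) * y ^ p.2)) :
    HasSum (fun p : ℕ × ℕ => a (p.1 + p.2 + 1) • (x ^ p.1 * (x * w - w * y) * y ^ p.2))
      (fx * w - w * fy) := by
  have htel : ∀ n : ℕ, ∑ p ∈ Finset.HasAntidiagonal.antidiagonal n,
      a (p.1 + p.2 + 1) • (x ^ p.1 * (x * w - w * y) * y ^ p.2) =
      a (n + 1) • (x ^ (n + 1) * w - w * y ^ (n + 1)) := by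
    intro n
    have h1 : ∀ p ∈ Finset.HasAntidiagonal.antidiagonal n,
        a (p.1 + p.2 + 1) • (x ^ p.1 * (x * w - w * y) * y ^ p.2) =
        a (n + 1) • (x ^ p.1 * (x * w - w * y) * y ^ p.2) := fun p hp => by
      rw [Finset.HasAntidiagonal.mem_antidiagonal.1 hp]
    rw [Finset.sum_congr rfl h1, ← Finset.smul_sum,
      Finset.Nat.sum_antidiagonal_eq_sum_range_succ
        (fun i j => x ^ i * (x * w - w * y) * y ^ j)]
    congr 1
    have h2 : ∀ k ∈ Finset.range n.succ, x ^ k * (x * w - w * y) * y ^ (n - k) =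
        x ^ (k + 1) * w * y ^ (n + 1 - (k + 1)) - x ^ k * w * y ^ (n + 1 - k) := fun k hk => by
      have : n + 1 - k = n - k + 1 := by
        have := Finset.mem_range.1 hk
        omega
      rw [Nat.add_sub_add_right, this, pow_succ, pow_succ' y]
      noncomm_ring
    rw [Finset.sum_congr rfl h2,
      Finset.sum_range_sub (fun k => x ^ k * w * y ^ (n + 1 - k))]
    simp
  obtain ⟨T, hT⟩ := hs
  have h1 : HasSum (fun n => a (n + 1) • (x ^ (n + 1) * w - w * y ^ (n + 1))) T := by
    have h := (Finset.HasAntidiagonal.sigmaAntidiagonalEquivProd.hasSum_iff.2 hT).sigma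
      fun n => hasSum_fintype _
    refine h.congr_fun ?_ |> fun h => h
    intro n
    rw [← htel n, ← Finset.sum_finset_coe]
    rfl
  have h2 : HasSum (fun n => a n • (x ^ n * w - w * y ^ n)) (fx * w - w * fy) := by
    refine ((hx.mul_right w).sub (hy.mul_left w)).congr_fun fun n => ?_
    rw [smul_mul_assoc, mul_smul_comm, smul_sub]
  rw [← hasSum_nat_add_iff' 1] at h2
  simp only [Finset.range_one, Finset.sum_singleton, pow_zero, one_mul, mul_one, sub_self,
    smul_zero, sub_zero] at h2
  rwa [h2.unique h1]

theorem hasSum_taylor {f : ℂ → ℂ} {R : ℝ} (hf : AnalyticOnNhd ℂ f (Metric.ball 0 R)) {z : ℂ}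
    (hz : ‖z‖ < R) :
    HasSum (fun n : ℕ => (iteratedDeriv n f 0 / (n.factorial : ℂ)) • z ^ n) (f z) := by
  refine (Complex.hasSum_taylorSeries_on_ball hf.differentiableOn
    (mem_ball_zero_iff.2 hz)).congr_fun fun n => ?_
  simp only [sub_zero, smul_eq_mul]
  ring

theorem summable_norm_taylor {f : ℂ → ℂ} {R : ℝ} (hf : AnalyticOnNhd ℂ f (Metric.ball 0 R))
    {ρ : ℝ} (hρ : 0 < ρ) (hρR : ρ < R) :
    Summable fun n : ℕ => ‖iteratedDeriv n f 0 / (n.factorial : ℂ)‖ * ρ ^ n := by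
  have h := (hasSum_taylor hf (z := ρ) (by
    rwa [Complex.norm_real, Real.norm_of_nonneg hρ.le])).summable.norm
  simpa only [norm_smul, norm_pow, Complex.norm_real, Real.norm_of_nonneg hρ.le] using h

theorem summable_norm_taylor_add {f : ℂ → ℂ} {R : ℝ} (hf : AnalyticOnNhd ℂ f (Metric.ball 0 R))
    {ρ : ℝ} (hρ : 0 < ρ) (hρR : ρ < R) : Summable fun p : ℕ × ℕ =>
      ‖iteratedDeriv (p.1 + p.2 + 1) f 0 / ((p.1 + p.2 + 1).factorial : ℂ)‖ *
        (ρ ^ p.1 * ρ ^ p.2) := by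
  -- Compare with a double geometric series, by the Cauchy estimate at a radius `σ > ρ`.
  obtain ⟨σ, hρσ, hσR⟩ := exists_between hρR
  have hσ := hρ.trans hρσ
  have hC := fun n => (summable_norm_taylor hf hσ hσR).le_tsum n fun k _ => by positivity
  set C := ∑' n : ℕ, ‖iteratedDeriv n f 0 / (n.factorial : ℂ)‖ * σ ^ n
  have hg : Summable fun n : ℕ => (ρ / σ) ^ n :=
    summable_geometric_of_lt_one (by positivity) ((div_lt_one hσ).2 hρσ)
  have hgg := (hg.mul_of_nonneg hg (fun n => by positivity) (fun n => by positivity)).mul_left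
    (C / σ)
  refine Summable.of_nonneg_of_le (fun p => by positivity) (fun p => ?_) hgg
  have h1 := hC (p.1 + p.2 + 1)
  rw [← le_div_iff₀ (by positivity)] at h1
  refine (mul_le_mul_of_nonneg_right h1 (by positivity)).trans_eq ?_
  rw [div_pow, div_pow]
  field_simp
  ring

theorem hasSum_dividedDifference {f : ℂ → ℂ} {R : ℝ} (hf : AnalyticOnNhd ℂ f (Metric.ball 0 R))
    {x y : ℂ} (hx : ‖x‖ < R) (hy : ‖y‖ < R) (hxy : x ≠ y) :
    HasSum (fun p : ℕ × ℕ =>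
      iteratedDeriv (p.1 + p.2 + 1) f 0 / ((p.1 + p.2 + 1).factorial : ℂ) * (x ^ p.1 * y ^ p.2))
      (dividedDifference f x y) := by
  obtain ⟨ρ, hρ, hρR⟩ := exists_between (max_lt hx hy)
  have hρ0 : 0 < ρ := (norm_nonneg x).trans_lt ((le_max_left _ _).trans_lt hρ)
  have hd := sub_ne_zero.2 hxy
  -- For this `w` the factor `x w - w y` in the identity for Banach algebras is `1`.
  have hw : x * (x - y)⁻¹ - (x - y)⁻¹ * y = 1 := by
    field_simp
  have hs : Summable fun p : ℕ × ℕ =>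
      iteratedDeriv (p.1 + p.2 + 1) f 0 / ((p.1 + p.2 + 1).factorial : ℂ) *
        (x ^ p.1 * y ^ p.2) := by
    refine (summable_norm_taylor_add hf hρ0 hρR).of_norm_bounded fun p => ?_
    rw [norm_mul, norm_mul, norm_pow, norm_pow]
    gcongr
    exacts [(le_max_left _ _).trans hρ.le, (le_max_right _ _).trans hρ.le]
  have h := hasSum_dividedDifference_mul (x - y)⁻¹ (hasSum_taylor hf hx) (hasSum_taylor hf hy) (by
    simpa only [hw, mul_one, smul_eq_mul] using hs)
  simp only [hw, mul_one, smul_eq_mul] at h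
  have hval : dividedDifference f x y = f x * (x - y)⁻¹ - (x - y)⁻¹ * f y := by
    rw [dividedDifference]
    ring
  rw [hval]
  exact h

theorem iteratedDeriv_const_mul_pow_div_factorial (c : ℂ) (n q : ℕ) (z : ℂ) :
    iteratedDeriv q (fun w => c * w ^ n) z / (q.factorial : ℂ) =
      c * ((n.choose q : ℂ) * z ^ (n - q)) := by
  have hq : (q.factorial : ℂ) ≠ 0 := by exact_mod_cast q.factorial_ne_zero
  rw [iteratedDeriv_const_mul_field, iteratedDeriv_pow,
    Nat.descFactorial_eq_factorial_mul_choose]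
  push_cast
  field_simp

/-- A normally convergent series of monomials can be differentiated termwise, by the Weierstrass
theorem on locally uniform limits of holomorphic functions. -/
theorem hasSum_iteratedDeriv_div_factorial {ι : Type*} {c : ι → ℂ} {n : ι → ℕ} {ρ : ℝ}
    (hs : Summable fun i => ‖c i‖ * ρ ^ n i) {U : Set ℂ} (hU : IsOpen U)
    (hUρ : U ⊆ Metric.ball 0 ρ) {g : ℂ → ℂ} (hg : ∀ w ∈ U, HasSum (fun i => c i * w ^ n i) (g w))
    {z : ℂ} (hz : z ∈ U) (q : ℕ) :
    HasSum (fun i => c i * (((n i).choose q : ℂ) * z ^ (n i - q)))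
      (iteratedDeriv q g z / (q.factorial : ℂ)) := by
  have hcd : ∀ t : Finset ι, ContDiff ℂ ⊤ fun w => ∑ i ∈ t, c i * w ^ n i := fun t => by fun_prop
  have h0 : TendstoLocallyUniformlyOn (fun (t : Finset ι) w => ∑ i ∈ t, c i * w ^ n i) g
      atTop U := by
    refine TendstoUniformlyOn.tendstoLocallyUniformlyOn ?_
    refine (tendstoUniformlyOn_tsum hs fun i w hw => ?_).congr_right fun w hw => (hg w hw).tsum_eq
    rw [norm_mul, norm_pow]
    gcongr
    exact (mem_ball_zero_iff.1 (hUρ hw)).le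
  have hq : ∀ q, TendstoLocallyUniformlyOn
      (fun (t : Finset ι) => iteratedDeriv q fun w => ∑ i ∈ t, c i * w ^ n i)
      (iteratedDeriv q g) atTop U := by
    intro q
    induction q with
    | zero => simpa only [iteratedDeriv_zero] using h0
    | succ q ih =>
      simp only [iteratedDeriv_succ]
      exact ih.deriv (Eventually.of_forall fun t =>
        ((hcd t).differentiable_iteratedDeriv q
          (by exact_mod_cast WithTop.coe_lt_top _)).differentiableOn) hU
  have h1 := ((hq q).tendsto_at hz).div_const (q.factorial : ℂ)
  refine h1.congr fun t => ?_
  rw [iteratedDeriv_fun_sum (fun i _ => by fun_prop), Finset.sum_div]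
  exact Finset.sum_congr rfl fun i _ => iteratedDeriv_const_mul_pow_div_factorial _ _ _ _

/-- The mixed Taylor coefficients of the divided difference, off the diagonal. -/
theorem hasSum_partialDeriv_dividedDifference {f : ℂ → ℂ} {R : ℝ}
    (hf : AnalyticOnNhd ℂ f (Metric.ball 0 R)) {x y : ℂ} (hx : ‖x‖ < R) (hy : ‖y‖ < R)
    (hxy : x ≠ y) (q₁ q₂ : ℕ) :
    HasSum (fun p : ℕ × ℕ =>
      iteratedDeriv (p.1 + p.2 + 1) f 0 / ((p.1 + p.2 + 1).factorial : ℂ) *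
        (((p.1.choose q₁ : ℂ) * x ^ (p.1 - q₁)) * ((p.2.choose q₂ : ℂ) * y ^ (p.2 - q₂))))
      (partialDeriv q₁ q₂ (dividedDifference f) x y /
        ((q₁.factorial : ℂ) * (q₂.factorial : ℂ))) := by
  obtain ⟨r, hr, hrR⟩ := exists_between (max_lt hx hy)
  obtain ⟨ρ, hrρ, hρR⟩ := exists_between hrR
  have hxr := (le_max_left _ _).trans_lt hr
  have hyr := (le_max_right _ _).trans_lt hr
  have hr0 : 0 < r := (norm_nonneg x).trans_lt hxr
  have hρ0 := hr0.trans hrρ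
  have hsum := summable_norm_taylor_add hf hρ0 hρR
  set a : ℕ → ℂ := fun n => iteratedDeriv n f 0 / (n.factorial : ℂ)
  -- The points `u = y` and `v = u` are removed because `dividedDifference` is `0` on the diagonal.
  have h1 : ∀ u ∈ Metric.ball (0 : ℂ) ρ \ {y}, HasSum (fun p : ℕ × ℕ =>
      a (p.1 + p.2 + 1) * ((p.2.choose q₂ : ℂ) * y ^ (p.2 - q₂)) * u ^ p.1)
      (iteratedDeriv q₂ (fun v => dividedDifference f u v) y / (q₂.factorial : ℂ)) := by
    intro u hu
    have huρ : ‖u‖ < ρ := mem_ball_zero_iff.1 hu.1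
    refine (hasSum_iteratedDeriv_div_factorial (c := fun p : ℕ × ℕ => a (p.1 + p.2 + 1) * u ^ p.1)
      (n := fun p => p.2) (ρ := ρ) (U := Metric.ball 0 ρ \ {u}) ?_
      (Metric.isOpen_ball.sdiff isClosed_singleton) Set.sdiff_subset ?_
      ⟨mem_ball_zero_iff.2 (hyr.trans hrρ), fun h => hu.2 h.symm⟩ q₂).congr_fun ?_
    · refine hsum.of_nonneg_of_le (fun p => by positivity) fun p => ?_
      rw [norm_mul, norm_pow, mul_assoc]
      gcongr
    · intro v hv
      refine (hasSum_dividedDifference hf (huρ.trans hρR)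
        ((mem_ball_zero_iff.1 hv.1).trans hρR) fun h => hv.2 h.symm).congr_fun fun p => ?_
      ring
    · intro p
      ring
  -- The second differentiation needs room between `‖y‖` and `ρ` to absorb the factor `j choose q₂`.
  have h2 := hasSum_iteratedDeriv_div_factorial
    (c := fun p : ℕ × ℕ => a (p.1 + p.2 + 1) * ((p.2.choose q₂ : ℂ) * y ^ (p.2 - q₂)))
    (n := fun p => p.1) (ρ := ρ) (U := Metric.ball 0 ρ \ {y}) (by
      refine (hsum.mul_left ((ρ - r) ^ q₂)⁻¹).of_nonneg_of_le (fun p => by positivity) fun p => ?_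
      have h := choose_mul_pow_le hr0.le (sub_pos.2 hrρ) p.2 q₂
      rw [add_sub_cancel] at h
      have h' : ‖(p.2.choose q₂ : ℂ) * y ^ (p.2 - q₂)‖ ≤ ((ρ - r) ^ q₂)⁻¹ * ρ ^ p.2 := by
        refine le_trans ?_ h
        rw [norm_mul, norm_pow, Complex.norm_natCast]
        gcongr
      rw [norm_mul]
      calc ‖a (p.1 + p.2 + 1)‖ * ‖(p.2.choose q₂ : ℂ) * y ^ (p.2 - q₂)‖ * ρ ^ p.1
          ≤ ‖a (p.1 + p.2 + 1)‖ * (((ρ - r) ^ q₂)⁻¹ * ρ ^ p.2) * ρ ^ p.1 := by gcongr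
        _ = _ := by ring)
    (Metric.isOpen_ball.sdiff isClosed_singleton) Set.sdiff_subset h1
    ⟨mem_ball_zero_iff.2 (hxr.trans hrρ), hxy⟩ q₁
  rw [iteratedDeriv_div_const, div_div, mul_comm (q₂.factorial : ℂ)] at h2
  refine h2.congr_fun fun p => ?_
  ring

end DividedDifference

/-! ### The double operator integral -/

section DoubleIntegral

variable {H : Type*} [NormedAddCommGroup H] [InnerProductSpace ℂ H]

/-- Inserting the power series of the divided difference turns the Riemann sums of the double
integral into a series of products of single Riemann sums. -/
theorem hasSum_binomRiemannSum_mul {S₁ S₂ : Set ℂ} {f : ℂ → ℂ} {R : ℝ}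
    (hf : AnalyticOnNhd ℂ f (Metric.ball 0 R))
    (hR₁ : ∀ z ∈ S₁, ‖z‖ < R) (hR₂ : ∀ z ∈ S₂, ‖z‖ < R) (hne : ∀ z₁ ∈ S₁, ∀ z₂ ∈ S₂, z₁ ≠ z₂)
    (X₁ X₂ : H →L[ℂ] H) (E₁ E₂ : SpectralMeasure H) (I₁ I₂ : ℂ → Finset ℕ) (Z : H →L[ℂ] H)
    (P : TaggedPartition S₁) (Q : TaggedPartition S₂) :
    HasSum (fun p : ℕ × ℕ =>
      (iteratedDeriv (p.1 + p.2 + 1) f 0 / ((p.1 + p.2 + 1).factorial : ℂ)) •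
        (binomRiemannSum E₁ X₁ I₁ p.1 P * Z * binomRiemannSum E₂ X₂ I₂ p.2 Q))
      (∑ A ∈ P.parts, ∑ B ∈ Q.parts, ∑ q₁ ∈ I₁ (P.tag A), ∑ q₂ ∈ I₂ (Q.tag B),
        (partialDeriv q₁ q₂ (dividedDifference f) (P.tag A) (Q.tag B) /
            ((q₁.factorial : ℂ) * (q₂.factorial : ℂ))) •
          ((X₁ - P.tag A • 1) ^ q₁ * E₁ A * Z * ((X₂ - Q.tag B • 1) ^ q₂ * E₂ B))) := by
  have h : HasSum (fun p : ℕ × ℕ => ∑ A ∈ P.parts, ∑ B ∈ Q.parts,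
      ∑ q₁ ∈ I₁ (P.tag A), ∑ q₂ ∈ I₂ (Q.tag B),
        (iteratedDeriv (p.1 + p.2 + 1) f 0 / ((p.1 + p.2 + 1).factorial : ℂ) *
          (((p.1.choose q₁ : ℂ) * P.tag A ^ (p.1 - q₁)) *
            ((p.2.choose q₂ : ℂ) * Q.tag B ^ (p.2 - q₂)))) •
          ((X₁ - P.tag A • 1) ^ q₁ * E₁ A * Z * ((X₂ - Q.tag B • 1) ^ q₂ * E₂ B))) _ :=
    hasSum_sum fun A hA => hasSum_sum fun B hB => hasSum_sum fun q₁ _ => hasSum_sum fun q₂ _ =>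
      (hasSum_partialDeriv_dividedDifference hf (hR₁ _ (P.tag_mem_set hA))
        (hR₂ _ (Q.tag_mem_set hB)) (hne _ (P.tag_mem_set hA) _ (Q.tag_mem_set hB))
        q₁ q₂).smul_const _
  refine h.congr_fun fun p => ?_
  simp only [binomRiemannSum]
  rw [Finset.sum_mul, Finset.sum_mul, Finset.smul_sum]
  refine Finset.sum_congr rfl fun A _ => ?_
  rw [Finset.mul_sum, Finset.smul_sum]
  refine Finset.sum_congr rfl fun B _ => ?_
  rw [Finset.sum_mul, Finset.sum_mul, Finset.smul_sum]
  refine Finset.sum_congr rfl fun q₁ _ => ?_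
  rw [Finset.mul_sum, Finset.smul_sum]
  refine Finset.sum_congr rfl fun q₂ _ => ?_
  simp only [smul_mul_assoc, mul_smul_comm, smul_smul]
  congr 1
  ring

namespace IsSpectralDecomposition

variable {X : H →L[ℂ] H} {E : SpectralMeasure H} {m : ℂ → ℕ}

theorem measurableSet_mem_Ico (h : IsSpectralDecomposition X E m) (q : ℕ) :
    MeasurableSet {z | q ∈ Finset.Ico 1 (m z)} := by
  simp only [Finset.mem_Ico]
  exact (MeasurableSet.const _).inter (h.measurable_order measurableSet_Ioi)

theorem exists_forall_mem_Ico_lt (h : IsSpectralDecomposition X E m) :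
    ∃ M : ℕ, ∀ z ∈ spectrum ℂ X, ∀ q ∈ Finset.Ico 1 (m z), q < M := by
  obtain ⟨M, hM⟩ := h.bounded_order
  exact ⟨M, fun z hz q hq => (Finset.mem_Ico.1 hq).2.trans_le (hM z hz)⟩

end IsSpectralDecomposition

variable [CompleteSpace H]

/-- Dominated convergence passes to the limit in the series of products: the double integral of
the divided difference exists, and it is the series formed from the single integrals. -/
theorem exists_hasDoubleIntegral_dividedDifference {f : ℂ → ℂ} {R : ℝ}
    (hf : AnalyticOnNhd ℂ f (Metric.ball 0 R)) {X₁ X₂ : H →L[ℂ] H} {E₁ E₂ : SpectralMeasure H}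
    {I₁ I₂ : ℂ → Finset ℕ} {M₁ M₂ : ℕ} (hM₁ : ∀ z ∈ spectrum ℂ X₁, ∀ q ∈ I₁ z, q < M₁)
    (hM₂ : ∀ z ∈ spectrum ℂ X₂, ∀ q ∈ I₂ z, q < M₂) {r : ℝ} (hr0 : 0 ≤ r) (hrR : r < R)
    (hr₁ : ∀ z ∈ spectrum ℂ X₁, ‖z‖ ≤ r) (hr₂ : ∀ z ∈ spectrum ℂ X₂, ‖z‖ ≤ r)
    (hne : ∀ z₁ ∈ spectrum ℂ X₁, ∀ z₂ ∈ spectrum ℂ X₂, z₁ ≠ z₂) {L₁ L₂ : ℕ → (H →L[ℂ] H)}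
    (hL₁ : ∀ i, Tendsto (fun P : TaggedPartition (spectrum ℂ X₁) => binomRiemannSum E₁ X₁ I₁ i P)
      atTop (𝓝 (L₁ i)))
    (hL₂ : ∀ i, Tendsto (fun P : TaggedPartition (spectrum ℂ X₂) => binomRiemannSum E₂ X₂ I₂ i P)
      atTop (𝓝 (L₂ i)))
    (Z : H →L[ℂ] H) : ∃ T, HasDoubleIntegral X₁ E₁ I₁ X₂ E₂ I₂ (dividedDifference f) Z T ∧
      HasSum (fun p : ℕ × ℕ =>
        (iteratedDeriv (p.1 + p.2 + 1) f 0 / ((p.1 + p.2 + 1).factorial : ℂ)) •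
          (L₁ p.1 * Z * L₂ p.2)) T := by
  obtain ⟨ρ, hrρ, hρR⟩ := exists_between hrR
  have hρ0 := hr0.trans_lt hrρ
  obtain ⟨C₁, hC₁0, hC₁⟩ := exists_norm_binomRiemannSum_le E₁ X₁ hM₁ hr0 hr₁ (sub_pos.2 hrρ)
  obtain ⟨C₂, hC₂0, hC₂⟩ := exists_norm_binomRiemannSum_le E₂ X₂ hM₂ hr0 hr₂ (sub_pos.2 hrρ)
  rw [add_sub_cancel] at hC₁ hC₂
  have := TaggedPartition.nonempty_of_measurableSet (spectrum.isClosed (𝕜 := ℂ) X₁).measurableSet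
  have := TaggedPartition.nonempty_of_measurableSet (spectrum.isClosed (𝕜 := ℂ) X₂).measurableSet
  have hsum := (summable_norm_taylor_add hf hρ0 hρR).mul_left (C₁ * ‖Z‖ * C₂)
  have hbound : ∀ (p : ℕ × ℕ) (U V : H →L[ℂ] H), ‖U‖ ≤ C₁ * ρ ^ p.1 → ‖V‖ ≤ C₂ * ρ ^ p.2 →
      ‖(iteratedDeriv (p.1 + p.2 + 1) f 0 / ((p.1 + p.2 + 1).factorial : ℂ)) • (U * Z * V)‖ ≤
      C₁ * ‖Z‖ * C₂ * (‖iteratedDeriv (p.1 + p.2 + 1) f 0 / ((p.1 + p.2 + 1).factorial : ℂ)‖ *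
        (ρ ^ p.1 * ρ ^ p.2)) := fun p U V hU hV => by
    rw [norm_smul]
    calc _ ≤ ‖iteratedDeriv (p.1 + p.2 + 1) f 0 / ((p.1 + p.2 + 1).factorial : ℂ)‖ *
          (C₁ * ρ ^ p.1 * ‖Z‖ * (C₂ * ρ ^ p.2)) := by
          gcongr
          refine (norm_mul_le _ _).trans ?_
          gcongr
          refine (norm_mul_le _ _).trans ?_
          gcongr
      _ = _ := by ring
  have hlim := tendsto_tsum_of_dominated_convergence
    (𝓕 := (atTop : Filter (TaggedPartition (spectrum ℂ X₁))) ×ˢ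
      (atTop : Filter (TaggedPartition (spectrum ℂ X₂)))) hsum
    (fun p => (((hL₁ p.1).comp tendsto_fst).mul_const Z |>.mul
      ((hL₂ p.2).comp tendsto_snd)).const_smul
        (iteratedDeriv (p.1 + p.2 + 1) f 0 / ((p.1 + p.2 + 1).factorial : ℂ)))
    (Eventually.of_forall fun PQ p => hbound p _ _ (hC₁ p.1 PQ.1) (hC₂ p.2 PQ.2))
  refine ⟨_, hlim.congr fun PQ => ?_, (Summable.of_norm_bounded hsum fun p => hbound p _ _
    (le_of_tendsto' (hL₁ p.1).norm fun P => hC₁ p.1 P)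
    (le_of_tendsto' (hL₂ p.2).norm fun P => hC₂ p.2 P)).hasSum⟩
  exact (hasSum_binomRiemannSum_mul hf (fun z hz => (hr₁ z hz).trans_lt hrR)
    (fun z hz => (hr₂ z hz).trans_lt hrR) hne X₁ X₂ E₁ E₂ I₁ I₂ Z PQ.1 PQ.2).tsum_eq

namespace IsSpectralDecomposition

variable {X : H →L[ℂ] H} {E : SpectralMeasure H} {m : ℂ → ℕ}

/-- The integrals of the scalar part and of the nilpotent part of `λ^i dE(λ)`. -/
theorem exists_tendsto_parts (h : IsSpectralDecomposition X E m) : ∃ L N : ℕ → (H →L[ℂ] H),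
    (∀ i, Tendsto (fun P : TaggedPartition (spectrum ℂ X) =>
      binomRiemannSum E X (fun _ => {0}) i P) atTop (𝓝 (L i))) ∧
    (∀ i, Tendsto (fun P : TaggedPartition (spectrum ℂ X) =>
      binomRiemannSum E X (fun z => Finset.Ico 1 (m z)) i P) atTop (𝓝 (N i))) ∧
    ∀ i, X ^ i = L i + N i := by
  have hS := (spectrum.isClosed (𝕜 := ℂ) X).measurableSet
  have := TaggedPartition.nonempty_of_measurableSet hS
  obtain ⟨r, hr⟩ := (spectrum.isCompact (𝕜 := ℂ) X).isBounded.exists_norm_le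
  obtain ⟨M, hM⟩ := h.exists_forall_mem_Ico_lt
  choose L hL using fun i => exists_tendsto_binomRiemannSum E X hS
    (fun q => MeasurableSet.const (q ∈ ({0} : Finset ℕ))) (M := 1) (by simp) hr i
  choose N hN using exists_tendsto_binomRiemannSum E X hS h.measurableSet_mem_Ico hM hr
  exact ⟨L, N, hL, hN, fun i => tendsto_nhds_unique (h.tendsto_binomRiemannSum_add i)
    ((hL i).add (hN i))⟩

theorem exists_norm_pow_le (h : IsSpectralDecomposition X E m) {r s : ℝ} (hr0 : 0 ≤ r)
    (hr : ∀ z ∈ spectrum ℂ X, ‖z‖ ≤ r) (hs : 0 < s) : ∃ C : ℝ, ∀ i, ‖X ^ i‖ ≤ C * (r + s) ^ i := by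
  have := TaggedPartition.nonempty_of_measurableSet (spectrum.isClosed (𝕜 := ℂ) X).measurableSet
  obtain ⟨M, hM⟩ := h.exists_forall_mem_Ico_lt
  obtain ⟨C, -, hC⟩ := exists_norm_binomRiemannSum_le E X (S := spectrum ℂ X)
    (I := fun _ => {0}) (M := 1) (by simp) hr0 hr hs
  obtain ⟨C', -, hC'⟩ := exists_norm_binomRiemannSum_le E X hM hr0 hr hs
  refine ⟨C + C', fun i => le_of_tendsto' (h.tendsto_binomRiemannSum_add i).norm fun P => ?_⟩
  rw [add_mul]
  exact norm_add_le_of_le (hC i P) (hC' i P)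

theorem exists_hasPowerSeriesValue (h : IsSpectralDecomposition X E m) {f : ℂ → ℂ} {R : ℝ}
    (hf : AnalyticOnNhd ℂ f (Metric.ball 0 R)) {r : ℝ} (hr0 : 0 ≤ r) (hrR : r < R)
    (hr : ∀ z ∈ spectrum ℂ X, ‖z‖ ≤ r) : ∃ T, HasPowerSeriesValue f X T := by
  obtain ⟨ρ, hrρ, hρR⟩ := exists_between hrR
  obtain ⟨C, hC⟩ := h.exists_norm_pow_le hr0 hr (sub_pos.2 hrρ)
  rw [add_sub_cancel] at hC
  refine Summable.of_norm_bounded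
    ((summable_norm_taylor hf (hr0.trans_lt hrρ) hρR).mul_left C) fun n => ?_
  rw [norm_smul, mul_left_comm]
  exact mul_le_mul_of_nonneg_left (hC n) (norm_nonneg _)

end IsSpectralDecomposition

theorem hasGDOI_dividedDifference {f : ℂ → ℂ} {R : ℝ} (hf : AnalyticOnNhd ℂ f (Metric.ball 0 R))
    {X₁ X₂ : H →L[ℂ] H} {E₁ E₂ : SpectralMeasure H} {m₁ m₂ : ℂ → ℕ}
    (h₁ : IsSpectralDecomposition X₁ E₁ m₁) (h₂ : IsSpectralDecomposition X₂ E₂ m₂)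
    {r : ℝ} (hr0 : 0 ≤ r) (hrR : r < R)
    (hr₁ : ∀ z ∈ spectrum ℂ X₁, ‖z‖ ≤ r) (hr₂ : ∀ z ∈ spectrum ℂ X₂, ‖z‖ ≤ r)
    (hne : ∀ z₁ ∈ spectrum ℂ X₁, ∀ z₂ ∈ spectrum ℂ X₂, z₁ ≠ z₂) {fX₁ fX₂ : H →L[ℂ] H}
    (hf₁ : HasPowerSeriesValue f X₁ fX₁) (hf₂ : HasPowerSeriesValue f X₂ fX₂) (Y : H →L[ℂ] H) :
    HasGDOI X₁ E₁ m₁ X₂ E₂ m₂ (dividedDifference f) (X₁ * Y - Y * X₂) (fX₁ * Y - Y * fX₂) := by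
  obtain ⟨L₁, N₁, hL₁, hN₁, hX₁⟩ := h₁.exists_tendsto_parts
  obtain ⟨L₂, N₂, hL₂, hN₂, hX₂⟩ := h₂.exists_tendsto_parts
  obtain ⟨M₁, hM₁⟩ := h₁.exists_forall_mem_Ico_lt
  obtain ⟨M₂, hM₂⟩ := h₂.exists_forall_mem_Ico_lt
  have h0 : ∀ z : ℂ, ∀ q ∈ ({0} : Finset ℕ), q < 1 := by simp
  obtain ⟨PP, hPP, sPP⟩ := exists_hasDoubleIntegral_dividedDifference hf (fun z _ => h0 z)
    (fun z _ => h0 z) hr0 hrR hr₁ hr₂ hne hL₁ hL₂ (X₁ * Y - Y * X₂)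
  obtain ⟨PN, hPN, sPN⟩ := exists_hasDoubleIntegral_dividedDifference hf (fun z _ => h0 z)
    hM₂ hr0 hrR hr₁ hr₂ hne hL₁ hN₂ (X₁ * Y - Y * X₂)
  obtain ⟨NP, hNP, sNP⟩ := exists_hasDoubleIntegral_dividedDifference hf hM₁
    (fun z _ => h0 z) hr0 hrR hr₁ hr₂ hne hN₁ hL₂ (X₁ * Y - Y * X₂)
  obtain ⟨NN, hNN, sNN⟩ := exists_hasDoubleIntegral_dividedDifference hf hM₁
    hM₂ hr0 hrR hr₁ hr₂ hne hN₁ hN₂ (X₁ * Y - Y * X₂)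
  have hsum : HasSum (fun p : ℕ × ℕ =>
      (iteratedDeriv (p.1 + p.2 + 1) f 0 / ((p.1 + p.2 + 1).factorial : ℂ)) •
        (X₁ ^ p.1 * (X₁ * Y - Y * X₂) * X₂ ^ p.2)) (PP + PN + NP + NN) := by
    refine (((sPP.add sPN).add sNP).add sNN).congr_fun fun p => ?_
    rw [hX₁, hX₂, ← smul_add, ← smul_add, ← smul_add]
    congr 1
    noncomm_ring
  exact ⟨PP, PN, NP, NN, hPP, hPN, hNP, hNN,
    (hasSum_dividedDifference_mul Y hf₁ hf₂ hsum.summable).unique hsum⟩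

end DoubleIntegral

theorem mainTheorem1 {H : Type*} [NormedAddCommGroup H] [InnerProductSpace ℂ H] [CompleteSpace H]
    (f : ℂ → ℂ) (R : ℝ) (hf : AnalyticOnNhd ℂ f (Metric.ball 0 R))
    (X₁ X₂ : H →L[ℂ] H) (E₁ E₂ : SpectralMeasure H) (m₁ m₂ : ℂ → ℕ)
    (h₁ : IsSpectralDecomposition X₁ E₁ m₁) (h₂ : IsSpectralDecomposition X₂ E₂ m₂)
    (hR₁ : ∀ z ∈ spectrum ℂ X₁, ‖z‖ < R) (hR₂ : ∀ z ∈ spectrum ℂ X₂, ‖z‖ < R)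
    (hne : ∀ z₁ ∈ spectrum ℂ X₁, ∀ z₂ ∈ spectrum ℂ X₂, z₁ ≠ z₂) :
    ∃ fX₁ fX₂ : H →L[ℂ] H,
      HasPowerSeriesValue f X₁ fX₁ ∧ HasPowerSeriesValue f X₂ fX₂ ∧
      (∀ Y : H →L[ℂ] H,
        HasGDOI X₁ E₁ m₁ X₂ E₂ m₂ (dividedDifference f) (X₁ * Y - Y * X₂)
          (fX₁ * Y - Y * fX₂)) ∧
      HasGDOI X₁ E₁ m₁ X₂ E₂ m₂ (dividedDifference f) (X₁ - X₂) (fX₁ - fX₂) := by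
  rcases subsingleton_or_nontrivial H with hH | hH
  · -- On the zero space the spectra are empty and `R` may fail to be positive.
    have hconst : ∀ (α : Type _) (l : Filter α) (g : α → (H →L[ℂ] H)) (T : H →L[ℂ] H),
        Tendsto g l (𝓝 T) := fun α l g T => by
      rw [show g = fun _ => T from funext fun _ => Subsingleton.elim _ _]
      exact tendsto_const_nhds
    have hG : ∀ Z T : H →L[ℂ] H, HasGDOI X₁ E₁ m₁ X₂ E₂ m₂ (dividedDifference f) Z T :=
      fun Z T => ⟨0, 0, 0, 0, hconst _ _ _ _, hconst _ _ _ _, hconst _ _ _ _, hconst _ _ _ _,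
        Subsingleton.elim _ _⟩
    exact ⟨0, 0, hconst _ _ _ _, hconst _ _ _ _, fun Y => hG _ _, hG _ _⟩
  · obtain ⟨w₁, hw₁, hmax₁⟩ := (spectrum.isCompact (𝕜 := ℂ) X₁).exists_isMaxOn
      (spectrum.nonempty X₁) continuous_norm.continuousOn
    obtain ⟨w₂, hw₂, hmax₂⟩ := (spectrum.isCompact (𝕜 := ℂ) X₂).exists_isMaxOn
      (spectrum.nonempty X₂) continuous_norm.continuousOn
    have hr0 : 0 ≤ max ‖w₁‖ ‖w₂‖ := le_max_of_le_left (norm_nonneg _)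
    have hrR : max ‖w₁‖ ‖w₂‖ < R := max_lt (hR₁ w₁ hw₁) (hR₂ w₂ hw₂)
    have hr₁ : ∀ z ∈ spectrum ℂ X₁, ‖z‖ ≤ max ‖w₁‖ ‖w₂‖ := fun z hz => le_max_of_le_left (hmax₁ hz)
    have hr₂ : ∀ z ∈ spectrum ℂ X₂, ‖z‖ ≤ max ‖w₁‖ ‖w₂‖ := fun z hz => le_max_of_le_right (hmax₂ hz)
    obtain ⟨fX₁, hf₁⟩ := h₁.exists_hasPowerSeriesValue hf hr0 hrR hr₁
    obtain ⟨fX₂, hf₂⟩ := h₂.exists_hasPowerSeriesValue hf hr0 hrR hr₂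
    have hG := hasGDOI_dividedDifference hf h₁ h₂ hr0 hrR hr₁ hr₂ hne hf₁ hf₂
    refine ⟨fX₁, fX₂, hf₁, hf₂, hG, ?_⟩
    simpa using hG 1
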